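/- Let $d\in\mathbb N$ and let $\gamma_d(dx)=\pi^{-d/2}e^{-|x|^2}\,dx$ be the Gaussian measure on $\mathbb R^d$. For a multi-index $\nu=(\nu_1,\dots,\nu_d)\in\mathbb N_0^d$ let $$h_\nu(x)=\frac{1}{(2^{|\nu|}\nu!)^{1/2}}\prod_{i=1}^d(-1)^{\nu_i}e^{x_i^2}\,\partial_{x_i}^{\nu_i}\bigl(e^{-x_i^2}\bigr)$$ be the normalized Hermite polynomials. They satisfy $Lh_\nu=-|\nu|h_\nu$ for the Ornstein–Uhlenbeck operator $L=\tfrac12\Delta-\langle x,\nabla\rangle$. Define the Ornstein–Uhlenbeck and Poisson–Hermite semigroups by $$T_tf(x)=\int_{\mathbb R^d}f\bigl(\sqrt{1-e^{-2t}}\,u+e^{-t}x\bigr)\,\gamma_d(du),\qquad P_tf(x)=\frac1{\sqrt\pi}\int_0^\infty\frac{e^{-u}}{\sqrt u}\,T_{t^2/4u}f(x)\,du .$$ For $\alpha\ge0$, let $k$ be the smallest integer with $k>\alpha$. For $1<p<\infty$ and $1\le q\le\infty$ put $$[f]_{\alpha,p,q}=\Bigl(\int_0^\infty\bigl(t^{k-\alpha}\bigl\|\partial_t^kP_tf\bigr\|_{L^p(\gamma_d)}\bigr)^q\frac{dt}{t}\Bigr)^{1/q}\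 (q<\infty),\qquad [f]_{\alpha,p,\infty}=\sup_{t>0}t^{k-\alpha}\bigl\|\partial_t^kP_tf\bigr\|_{L^p(\gamma_d)} .$$ The Gaussian Besov–Lipschitz space $B^\alpha_{p,q}(\gamma_d)$ is the set of $f\in L^p(\gamma_d)$ with $[f]_{\alpha,p,q}<\infty$, with the norm $\|f\|_{B^\alpha_{p,q}}=\|f\|_{L^p(\gamma_d)}+[f]_{\alpha,p,q}$. Let $\alpha\ge0$, $\beta>0$, $1<p<\infty$ and $1\le q\le\infty$. Then there is exactly one continuous linear operator $I_\beta$ on $L^p(\gamma_d)$ (real-valued functions) with $I_\beta h_0=0$ and $I_\beta h_\nu=|\nu|^{-\beta/2}h_\nu$ for all $\nu\ne0$; this is the Riesz potential $I_\beta=(-L)^{-\beta/2}\Pi_0$, where $\Pi_0f=f-\int f\,d\gamma_d$. It is bounded from $B^\alpha_{p,q}(\gamma_d)$ into $B^{\alpha+\beta}_{p,q}(\gamma_d)$: there is a constant $C<\infty$, depending only on $d,\alpha,\beta,p,q$, such that for every $f\in B^\alpha_{p,q}(\gamma_d)$ one has $I_\beta f\in B^{\alpha+\beta}_{p,q}(\gamma_d)$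 and $$\|I_\beta f\|_{B^{\alpha+\beta}_{p,q}}\le C\,\|f\|_{B^\alpha_{p,q}} .$$ -/

import Mathlib

open MeasureTheory
open scoped ENNReal NNReal

noncomputable section

/-- The Gaussian measure `π^{-d/2} e^{-|x|²} dx` on `ℝ^d`. -/
def gaussianMeas (d : ℕ) : Measure (EuclideanSpace ℝ (Fin d)) :=
  volume.withDensity fun x =>
    ENNReal.ofReal (Real.exp (-‖x‖ ^ 2) / Real.pi ^ ((d : ℝ) / 2))

/-- The normalized Hermite polynomial `h_ν`, as a function on `ℝ^d`:
`(2^{|ν|} ν!)^{-1/2} ∏ᵢ (-1)^{νᵢ} e^{xᵢ²} ∂ᵢ^{νᵢ} e^{-xᵢ²}`. -/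
def hermiteFun {d : ℕ} (ν : Fin d → ℕ) (x : EuclideanSpace ℝ (Fin d)) : ℝ :=
  (Real.sqrt ((2 : ℝ) ^ (∑ i, ν i) * ∏ i, ((ν i).factorial : ℝ)))⁻¹ *
    ∏ i, ((-1 : ℝ) ^ ν i * Real.exp (x i ^ 2) *
      iteratedDeriv (ν i) (fun y : ℝ => Real.exp (-y ^ 2)) (x i))

/-- The Ornstein-Uhlenbeck semigroup
`T_t f(x) = ∫ f(√(1 - e^{-2t}) u + e^{-t} x) γ_d(du)`, `t ≥ 0`. -/
def ouSemigroup {d : ℕ} (t : ℝ) (f : EuclideanSpace ℝ (Fin d) → ℝ)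
    (x : EuclideanSpace ℝ (Fin d)) : ℝ :=
  ∫ u, f (Real.sqrt (1 - Real.exp (-2 * t)) • u + Real.exp (-t) • x) ∂(gaussianMeas d)

/-- The Poisson-Hermite semigroup, by Bochner subordination:
`P_t f(x) = π^{-1/2} ∫_0^∞ e^{-u} u^{-1/2} T_{t²/(4u)} f(x) du`, `t ≥ 0`. -/
def poissonHermite {d : ℕ} (t : ℝ) (f : EuclideanSpace ℝ (Fin d) → ℝ)
    (x : EuclideanSpace ℝ (Fin d)) : ℝ :=
  (Real.sqrt Real.pi)⁻¹ *
    ∫ u in Set.Ioi (0 : ℝ), Real.exp (-u) / Real.sqrt u * ouSemigroup (t ^ 2 / (4 * u)) f x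

/-- `‖∂^k P_t f / ∂t^k‖_{p, γ_d}`, with the derivative in `t` taken pointwise in `x`. -/
def poissonDerivNorm {d : ℕ} (p : ℝ≥0∞) (k : ℕ) (f : EuclideanSpace ℝ (Fin d) → ℝ)
    (t : ℝ) : ℝ≥0∞ :=
  eLpNorm (fun x => iteratedDeriv k (fun s : ℝ => poissonHermite s f x) t) p (gaussianMeas d)

/-- The Besov-Lipschitz seminorm of order `α ≥ 0`, with `k = ⌊α⌋ + 1` the smallest integer
greater than `α`: `(∫_0^∞ (t^{k-α} ‖∂_t^k P_t f‖_p)^q dt/t)^{1/q}` for `q < ∞`, and for `q = ∞`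
the smallest `A ∈ [0,∞]` with `t^{k-α} ‖∂_t^k P_t f‖_p ≤ A` for all `t > 0`. -/
def besovSeminorm {d : ℕ} (α : ℝ) (p q : ℝ≥0∞) (f : EuclideanSpace ℝ (Fin d) → ℝ) : ℝ≥0∞ :=
  if q = ∞ then
    ⨆ t ∈ Set.Ioi (0 : ℝ),
      ENNReal.ofReal (t ^ (((⌊α⌋₊ + 1 : ℕ) : ℝ) - α)) * poissonDerivNorm p (⌊α⌋₊ + 1) f t
  else
    (∫⁻ t in Set.Ioi (0 : ℝ),
      (ENNReal.ofReal (t ^ (((⌊α⌋₊ + 1 : ℕ) : ℝ) - α)) *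
        poissonDerivNorm p (⌊α⌋₊ + 1) f t) ^ q.toReal * ENNReal.ofReal t⁻¹) ^ (1 / q.toReal)

/-- The Besov-Lipschitz norm `‖f‖_{p, γ_d} +` seminorm (as an extended number). -/
def besovNorm {d : ℕ} (α : ℝ) (p q : ℝ≥0∞) (f : EuclideanSpace ℝ (Fin d) → ℝ) : ℝ≥0∞ :=
  eLpNorm f p (gaussianMeas d) + besovSeminorm α p q f

/-- The Gaussian Besov-Lipschitz space `B^α_{p,q}(γ_d)`, a subset of `L^p(γ_d)`. -/
def besovSpace (d : ℕ) (α : ℝ) (p q : ℝ≥0∞) : Set (Lp ℝ p (gaussianMeas d)) :=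
  {f | besovSeminorm α p q f < ∞}

/-- `I` is the Riesz potential `(-L)^{-β/2} Π₀` on `L^p(γ_d)`: the continuous linear operator
with `I h_0 = 0` and `I h_ν = |ν|^{-β/2} h_ν` for `ν ≠ 0`. -/
def IsRieszPotential {d : ℕ} (β : ℝ) {p : ℝ≥0∞} [Fact (1 ≤ p)]
    (I : Lp ℝ p (gaussianMeas d) →L[ℝ] Lp ℝ p (gaussianMeas d)) : Prop :=
  ∀ ν : Fin d → ℕ, ∃ h : MemLp (hermiteFun ν) p (gaussianMeas d),
    I (h.toLp (hermiteFun ν)) =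
      (if ν = 0 then 0 else ((∑ i, ν i : ℕ) : ℝ) ^ (-(β / 2))) • h.toLp (hermiteFun ν)

end

/-! Every operator involved is diagonal on the Hermite polynomials: `T_t` multiplies `h_ν` by
`e^{-t|ν|}`, and `∂_t^k P_t` multiplies it by `(-√|ν|)^k e^{-t√|ν|}`. Their span is dense in
`L^p(γ)` (`dense_span_hermiteLp`), so an identity between bounded operators reduces to a scalar
identity for each `ν` (`clm_ext_hermiteLp`). In particular the Riesz potential is unique.

Existence: `I_β = Γ(β/2)⁻¹ ∫_0^∞ τ^{β/2-1} (T_τ - T_∞) dτ`, where `T_∞` is the mean. The integral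
converges in norm because `‖T_τ - T_∞‖ ≤ C e^{-τ}` on `L^p`, `1 < p < ∞`
(`exists_norm_mehlerOp_sub_le`). This comes from comparing the Mehler kernel with `1` and applying
Hölder; symmetry of the kernel and Jensen give contractivity.

Boundedness: for an integer `n > β`, the Gamma integral for `|ν|^{-β/2}` gives `∂_t^n P_t I_β f =
Γ(β)⁻¹ t^β ∫_0^∞ σ^{β-1} (∂^n P)_{t(1+σ)} f dσ` (`poissonOp_rieszPotential`). Let `k` and `n = j +
k` be the smallest integers above `α` and `α + β`. The semigroup law splits `(∂^n P)_r` as `(∂^j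
P)_{r/2} (∂^k P)_{r/2}`, and the first factor has norm at most a constant times `r^{-j}`. Hence
`t^{n-α-β} ‖∂_t^n P_t I_β f‖` is at most an average over `σ` of `G((1+σ)t/2)`, where `G(t) = t^{k-α}
‖∂_t^k P_t f‖`, with weight a multiple of `σ^{β-1} (1+σ)^{-(n-α)}`. The weight is integrable exactly
because `β > 0` and `n > α + β`. As `dt/t` is dilation invariant, such averages are bounded on
`L^q(dt/t)` for every `q ≥ 1`, including `q = ∞`.

The seminorm uses derivatives in `t` taken pointwise in `x`, whereas the argument uses `L^p`-valued
integrals; `iteratedDeriv_poissonHermite_ae` identifies the two. -/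

/-! ### One-variable Hermite polynomials and Mehler's formula. -/

open Polynomial in
/-- The physicists' Hermite polynomials, as real polynomials. -/
noncomputable def physHermite : ℕ → Polynomial ℝ
  | 0 => 1
  | n + 1 => C 2 * X * physHermite n - derivative (physHermite n)

theorem derivative_physHermite (n : ℕ) :
    Polynomial.derivative (physHermite (n + 1)) =
      Polynomial.C (2 * ((n : ℝ) + 1)) * physHermite n := by
  induction n with
  | zero => simp [physHermite]
  | succ n ih =>
    rw [physHermite, Polynomial.derivative_sub, ih]
    simp only [Polynomial.derivative_mul, Polynomial.derivative_C, Polynomial.derivative_X, ih]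
    conv_rhs => rw [physHermite]
    simp only [Nat.cast_add, Nat.cast_one, map_mul, map_add, map_one]
    have : (Polynomial.C 2 : Polynomial ℝ) = 2 := rfl
    rw [show physHermite (n + 1) =
      Polynomial.C 2 * Polynomial.X * physHermite n - Polynomial.derivative (physHermite n) from rfl]
    rw [this]
    ring

theorem physHermite_succ_succ (n : ℕ) :
    physHermite (n + 2) = Polynomial.C 2 * Polynomial.X * physHermite (n + 1) -
      Polynomial.C (2 * ((n : ℝ) + 1)) * physHermite n := by
  rw [physHermite, derivative_physHermite]

/-- The recursion `H_{n+1} = 2y H_n - H_n'` is chosen so that differentiating `H_n e^{-y²}` produces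
`-H_{n+1} e^{-y²}`; iterating gives the Rodrigues formula. -/
theorem hasDerivAt_physHermite_mul_gaussian (n : ℕ) (y : ℝ) :
    HasDerivAt (fun y => (physHermite n).eval y * Real.exp (-y ^ 2))
      (-((physHermite (n + 1)).eval y * Real.exp (-y ^ 2))) y := by
  have h1 := (physHermite n).hasDerivAt y
  have h2 : HasDerivAt (fun y : ℝ => Real.exp (-y ^ 2)) (Real.exp (-y ^ 2) * (-(2 * y))) y := by
    have := ((hasDerivAt_pow 2 y).neg).exp
    simpa using this
  refine (h1.mul h2).congr_deriv ?_
  simp [physHermite]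
  ring

theorem iteratedDeriv_gaussian (n : ℕ) :
    iteratedDeriv n (fun y : ℝ => Real.exp (-y ^ 2)) =
      fun y => (-1) ^ n * ((physHermite n).eval y * Real.exp (-y ^ 2)) := by
  induction n with
  | zero => ext; simp [physHermite]
  | succ n ih =>
    rw [iteratedDeriv_succ, ih]
    ext y
    rw [((hasDerivAt_physHermite_mul_gaussian n y).const_mul _).deriv]
    ring

theorem hermiteFun_eq {d : ℕ} (ν : Fin d → ℕ) (x : EuclideanSpace ℝ (Fin d)) :
    hermiteFun ν x = (Real.sqrt ((2 : ℝ) ^ (∑ i, ν i) * ∏ i, ((ν i).factorial : ℝ)))⁻¹ *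
      ∏ i, (physHermite (ν i)).eval (x i) := by
  unfold hermiteFun
  congr 1
  refine Finset.prod_congr rfl fun i _ => ?_
  rw [iteratedDeriv_gaussian]
  have h1 : ((-1 : ℝ) ^ ν i) * (-1) ^ ν i = 1 := by rw [← mul_pow]; simp
  have h2 : Real.exp (x i ^ 2) * Real.exp (-x i ^ 2) = 1 := by rw [← Real.exp_add]; simp
  linear_combination ((physHermite (ν i)).eval (x i)) * h1 +
    ((-1 : ℝ) ^ ν i) * (-1) ^ ν i * ((physHermite (ν i)).eval (x i)) * h2

theorem integrable_polynomial_mul_gaussian (P : Polynomial ℝ) :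
    Integrable fun y : ℝ => P.eval y * Real.exp (-y ^ 2) := by
  have : (fun y : ℝ => P.eval y * Real.exp (-y ^ 2)) =
      fun y => ∑ i ∈ Finset.range (P.natDegree + 1), P.coeff i * (y ^ i * Real.exp (-y ^ 2)) := by
    ext y
    rw [Polynomial.eval_eq_sum_range, Finset.sum_mul]
    simp [mul_assoc]
  rw [this]
  refine integrable_finsetSum _ fun i _ => Integrable.const_mul ?_ _
  have := integrable_rpow_mul_exp_neg_mul_sq (b := 1) one_pos (s := i)
    (by have : (0 : ℝ) ≤ i := Nat.cast_nonneg i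
        linarith)
  simpa using this

/-- Gaussian integration by parts: the derivative of the integrable function `P e^{-y²}` is
integrable, so it has integral zero. -/
theorem integral_mul_gaussian_polynomial (P : Polynomial ℝ) :
    ∫ y : ℝ, 2 * y * P.eval y * Real.exp (-y ^ 2) =
      ∫ y : ℝ, (Polynomial.derivative P).eval y * Real.exp (-y ^ 2) := by
  have h0 : ∀ y : ℝ, HasDerivAt (fun y => P.eval y * Real.exp (-y ^ 2))
      ((Polynomial.derivative P).eval y * Real.exp (-y ^ 2)
        - 2 * y * P.eval y * Real.exp (-y ^ 2)) y := by
    intro y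
    have h1 := P.hasDerivAt y
    have h2 : HasDerivAt (fun y : ℝ => Real.exp (-y ^ 2)) (Real.exp (-y ^ 2) * (-(2 * y))) y := by
      have := ((hasDerivAt_pow 2 y).neg).exp
      simpa using this
    refine (h1.mul h2).congr_deriv ?_
    ring
  have i1 := integrable_polynomial_mul_gaussian (Polynomial.derivative P)
  have i2 : Integrable fun y : ℝ => 2 * y * P.eval y * Real.exp (-y ^ 2) := by
    have := integrable_polynomial_mul_gaussian (Polynomial.C 2 * Polynomial.X * P)
    simpa using this
  have := integral_eq_zero_of_hasDerivAt_of_integrable h0 (i1.sub i2)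
    (integrable_polynomial_mul_gaussian P)
  rw [integral_sub i1 i2] at this
  linarith

/-- Mehler's formula for one-dimensional Hermite polynomials. -/
theorem integral_physHermite_comp (c r : ℝ) (h : c ^ 2 + r ^ 2 = 1) (n : ℕ) (y : ℝ) :
    ∫ v : ℝ, (physHermite n).eval (c * v + r * y) * Real.exp (-v ^ 2) =
      Real.sqrt Real.pi * (r ^ n * (physHermite n).eval y) := by
  have hint : ∀ Q : Polynomial ℝ, Integrable fun v : ℝ => Q.eval (c * v + r * y) *
      Real.exp (-v ^ 2) := by
    intro Q
    have := integrable_polynomial_mul_gaussian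
      (Q.comp (Polynomial.C c * Polynomial.X + Polynomial.C (r * y)))
    simpa using this
  -- Integration by parts in `v` turns the term `2cv Q` into `c² Q'`, and `c² - 1 = -r²`. For `Q =
  -- H_{n+1}` this is the three-term recurrence satisfied by `r^n H_n(y)`.
  have key : ∀ Q : Polynomial ℝ, ∫ v : ℝ, (Polynomial.C 2 * Polynomial.X * Q -
      Polynomial.derivative Q).eval (c * v + r * y) * Real.exp (-v ^ 2) =
      2 * r * y * (∫ v : ℝ, Q.eval (c * v + r * y) * Real.exp (-v ^ 2)) -
      r ^ 2 * (∫ v : ℝ, (Polynomial.derivative Q).eval (c * v + r * y) * Real.exp (-v ^ 2)) := by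
    intro Q
    have h1 := integral_mul_gaussian_polynomial
      (Q.comp (Polynomial.C c * Polynomial.X + Polynomial.C (r * y)))
    have i1 := integrable_polynomial_mul_gaussian (Polynomial.C 2 * Polynomial.X *
      (Q.comp (Polynomial.C c * Polynomial.X + Polynomial.C (r * y))))
    simp [Polynomial.derivative_comp] at h1 i1
    have e : ∀ v : ℝ, (Polynomial.C 2 * Polynomial.X * Q -
      Polynomial.derivative Q).eval (c * v + r * y) * Real.exp (-v ^ 2) =
       2 * r * y * (Q.eval (c * v + r * y) * Real.exp (-v ^ 2)) +
       (c * (2 * v * Q.eval (c * v + r * y) * Real.exp (-v ^ 2)) -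
       ((Polynomial.derivative Q).eval (c * v + r * y) * Real.exp (-v ^ 2))) := by
      intro v; simp; ring
    simp_rw [e]
    have h2 := integral_add ((hint Q).const_mul (2 * r * y))
      ((i1.const_mul c).sub (hint (Polynomial.derivative Q)))
    have h3 := integral_sub (i1.const_mul c) (hint (Polynomial.derivative Q))
    simp only [Pi.sub_apply] at h2
    rw [h2, h3, integral_const_mul, integral_const_mul, h1]
    simp_rw [mul_assoc c]
    rw [integral_const_mul]
    linear_combination (∫ v : ℝ, (Polynomial.derivative Q).eval (c * v + r * y) *
      Real.exp (-v ^ 2)) * h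
  induction n using Nat.twoStepInduction with
  | zero =>
    have := integral_gaussian 1
    simp at this
    simp [physHermite, this]
  | one =>
    have := integral_gaussian 1
    simp at this
    have k := key 1
    simp only [physHermite]
    rw [k]
    simp [this]; ring
  | more n ih1 ih2 =>
    have k := key (physHermite (n + 1))
    rw [show physHermite (n + 2) = Polynomial.C 2 * Polynomial.X * physHermite (n + 1) -
      Polynomial.derivative (physHermite (n + 1)) from rfl, k, ih2, derivative_physHermite]
    simp only [Polynomial.eval_mul, Polynomial.eval_C, mul_assoc (2 * ((n : ℝ) + 1))]
    rw [integral_const_mul, ih1]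
    simp
    ring

/-! ### The Gaussian measure and its integrability classes. -/

/-- The density of the Gaussian measure with respect to Lebesgue measure. -/
noncomputable def gaussDensity (d : ℕ) (x : EuclideanSpace ℝ (Fin d)) : ℝ :=
  Real.exp (-‖x‖ ^ 2) / Real.pi ^ ((d : ℝ) / 2)

theorem continuous_gaussDensity (d : ℕ) : Continuous (gaussDensity d) := by
  unfold gaussDensity; fun_prop

theorem integral_gaussianMeas {d : ℕ} {F : Type*} [NormedAddCommGroup F] [NormedSpace ℝ F]
    (f : EuclideanSpace ℝ (Fin d) → F) :
    ∫ x, f x ∂(gaussianMeas d) = ∫ x, gaussDensity d x • f x := by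
  unfold gaussianMeas
  rw [integral_withDensity_eq_integral_toReal_smul]
  · refine integral_congr_ae (Filter.Eventually.of_forall fun x => ?_)
    simp only
    rw [ENNReal.toReal_ofReal (by positivity)]
    rfl
  · exact (continuous_gaussDensity d).measurable.ennreal_ofReal
  · simp

theorem integrable_gaussianMeas_iff {d : ℕ} {F : Type*} [NormedAddCommGroup F] [NormedSpace ℝ F]
    (f : EuclideanSpace ℝ (Fin d) → F) :
    Integrable f (gaussianMeas d) ↔ Integrable fun x => gaussDensity d x • f x := by
  unfold gaussianMeas
  rw [integrable_withDensity_iff_integrable_smul']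
  · refine integrable_congr (Filter.Eventually.of_forall fun x => ?_)
    simp only
    rw [ENNReal.toReal_ofReal (by positivity)]
    rfl
  · exact (continuous_gaussDensity d).measurable.ennreal_ofReal
  · simp

/-- A non-integrable function has Bochner integral `0`, so the known nonzero value of the integral
already forces integrability. -/
theorem integrable_exp_neg_mul_norm_sq {d : ℕ} {b : ℝ} (hb : 0 < b) :
    Integrable fun x : EuclideanSpace ℝ (Fin d) => Real.exp (-b * ‖x‖ ^ 2) := by
  refine Integrable.of_integral_ne_zero ?_
  rw [GaussianFourier.integral_rexp_neg_mul_sq_norm hb]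
  positivity

theorem integrable_exp_mul_norm_sq_gaussianMeas (d : ℕ) {c : ℝ} (hc : c < 1) :
    Integrable (fun x => Real.exp (c * ‖x‖ ^ 2)) (gaussianMeas d) := by
  rw [integrable_gaussianMeas_iff]
  have := (integrable_exp_neg_mul_norm_sq (d := d) (b := 1 - c) (by linarith)).const_mul
    (Real.pi ^ ((d : ℝ) / 2))⁻¹
  refine this.congr (Filter.Eventually.of_forall fun x => ?_)
  simp only [gaussDensity, smul_eq_mul]
  rw [show -(1 - c) * ‖x‖ ^ 2 = -‖x‖ ^ 2 + c * ‖x‖ ^ 2 by ring, Real.exp_add]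
  field_simp

instance isProbabilityMeasure_gaussianMeas (d : ℕ) : IsProbabilityMeasure (gaussianMeas d) := by
  have h1 : ∫ _, (1 : ℝ) ∂(gaussianMeas d) = 1 := by
    rw [integral_gaussianMeas]
    simp only [gaussDensity, smul_eq_mul, mul_one]
    rw [integral_div]
    have := GaussianFourier.integral_rexp_neg_mul_sq_norm (V := EuclideanSpace ℝ (Fin d)) one_pos
    simp at this
    rw [this]
    exact div_self (by positivity)
  have h2 : Integrable (fun _ => (1 : ℝ)) (gaussianMeas d) :=
    Integrable.of_integral_ne_zero (by rw [h1]; exact one_ne_zero)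
  rw [integrable_const_iff_isFiniteMeasure one_ne_zero] at h2
  constructor
  simp [measureReal_def] at h1
  rw [ENNReal.toReal_eq_one_iff] at h1
  exact h1

theorem memLp_of_le_exp {d : ℕ} {p : ℝ≥0∞} (hp : p ≠ ∞) {f : EuclideanSpace ℝ (Fin d) → ℝ}
    (hf : AEStronglyMeasurable f (gaussianMeas d)) {c : ℝ} (hc : c * p.toReal < 1) (A : ℝ)
    (h : ∀ x, |f x| ≤ A * Real.exp (c * ‖x‖ ^ 2)) : MemLp f p (gaussianMeas d) := by
  have h1 : MemLp (fun x : EuclideanSpace ℝ (Fin d) => Real.exp (c * ‖x‖ ^ 2)) p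
      (gaussianMeas d) := by
    by_cases hp0 : p = 0
    · subst hp0
      rw [memLp_zero_iff_aestronglyMeasurable]
      exact (by fun_prop : Continuous fun x : EuclideanSpace ℝ (Fin d) =>
        Real.exp (c * ‖x‖ ^ 2)).aestronglyMeasurable
    rw [← integrable_norm_rpow_iff _ hp0 hp]
    · refine (integrable_exp_mul_norm_sq_gaussianMeas d hc).congr
        (Filter.Eventually.of_forall fun x => ?_)
      simp only [Real.norm_eq_abs, Real.abs_exp]
      rw [← Real.exp_mul]; ring_nf
    · exact (by fun_prop : Continuous fun x : EuclideanSpace ℝ (Fin d) =>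
        Real.exp (c * ‖x‖ ^ 2)).aestronglyMeasurable
  refine MemLp.of_le (h1.const_mul A) hf (Filter.Eventually.of_forall fun x => ?_)
  simp only [Real.norm_eq_abs]
  exact (h x).trans (le_abs_self _)

/-- Integrals of products of functions of the coordinates against the Gaussian measure. -/
theorem integral_prod_gaussianMeas {d : ℕ} (f : Fin d → ℝ → ℝ) :
    ∫ x, ∏ i, f i (x i) ∂(gaussianMeas d) =
      ∏ i, ((Real.sqrt Real.pi)⁻¹ * ∫ v : ℝ, f i v * Real.exp (-v ^ 2)) := by
  rw [integral_gaussianMeas, Finset.prod_mul_distrib, ← integral_fintype_prod_volume_eq_prod,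
    ← (PiLp.volume_preserving_ofLp (Fin d)).integral_comp
      (MeasurableEquiv.toLp 2 (Fin d → ℝ)).symm.measurableEmbedding, ← integral_const_mul]
  refine integral_congr_ae (Filter.Eventually.of_forall fun x => ?_)
  simp only [gaussDensity, smul_eq_mul, Finset.prod_const, Finset.card_univ, Fintype.card_fin,
    Finset.prod_mul_distrib, ← Real.exp_sum, EuclideanSpace.norm_sq_eq, Real.norm_eq_abs, sq_abs,
    Finset.sum_neg_distrib]
  rw [show Real.pi ^ ((d : ℝ) / 2) = Real.sqrt Real.pi ^ d by
    rw [Real.sqrt_eq_rpow, ← Real.rpow_mul_natCast Real.pi_pos.le]; congr 1; ring]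
  rw [inv_pow]
  ring

/-! ### The Mehler kernel and its bounds. -/

/-- The Mehler kernel, the density of the law of `√(1 - r²) u + r x` with respect to the
Gaussian measure. -/
noncomputable def mehler {d : ℕ} (r : ℝ) (x y : EuclideanSpace ℝ (Fin d)) : ℝ :=
  (Real.sqrt (1 - r ^ 2) ^ d)⁻¹ *
    Real.exp ((2 * r * inner ℝ x y - r ^ 2 * ‖x‖ ^ 2 - r ^ 2 * ‖y‖ ^ 2) / (1 - r ^ 2))

theorem mehler_symm {d : ℕ} (r : ℝ) (x y : EuclideanSpace ℝ (Fin d)) :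
    mehler r x y = mehler r y x := by
  unfold mehler
  rw [real_inner_comm]
  ring_nf

theorem mehler_nonneg {d : ℕ} (r : ℝ) (x y : EuclideanSpace ℝ (Fin d)) : 0 ≤ mehler r x y := by
  unfold mehler; positivity

theorem Measurable.mehler {d : ℕ} {α : Type*} [MeasurableSpace α] {f : α → ℝ}
    {g h : α → EuclideanSpace ℝ (Fin d)} (hf : Measurable f) (hg : Measurable g)
    (hh : Measurable h) : Measurable fun z => mehler (f z) (g z) (h z) := by
  unfold _root_.mehler; fun_prop

/-- Completing the square: the inequality of exponents amounts to `‖x - r y‖² ≥ 0`. The bound is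
uniform in `y`, so for fixed `x` integration against the kernel is a bounded functional on `L^p`. -/
theorem mehler_le {d : ℕ} {r : ℝ} (hr : r ^ 2 < 1) (x y : EuclideanSpace ℝ (Fin d)) :
    mehler r x y ≤ (Real.sqrt (1 - r ^ 2) ^ d)⁻¹ * Real.exp (‖x‖ ^ 2) := by
  unfold mehler
  gcongr
  rw [div_le_iff₀ (by linarith)]
  have := norm_sub_sq_real x (r • y)
  rw [norm_smul, inner_smul_right, mul_pow, Real.norm_eq_abs, sq_abs] at this
  nlinarith [sq_nonneg ‖x - r • y‖]

theorem integral_comp_affine_gaussianMeas {d : ℕ} {r : ℝ} (hr : r ^ 2 < 1)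
    (f : EuclideanSpace ℝ (Fin d) → ℝ) (x : EuclideanSpace ℝ (Fin d)) :
    ∫ u, f (Real.sqrt (1 - r ^ 2) • u + r • x) ∂(gaussianMeas d) =
      ∫ y, mehler r x y * f y ∂(gaussianMeas d) := by
  set c := Real.sqrt (1 - r ^ 2) with hc
  have hc0 : 0 < c := Real.sqrt_pos.2 (by linarith)
  have hc2 : c ^ 2 = 1 - r ^ 2 := Real.sq_sqrt (by linarith)
  rw [integral_gaussianMeas, integral_gaussianMeas]
  have h1 : ∀ u, gaussDensity d u • f (c • u + r • x) =
      (fun y => gaussDensity d (c⁻¹ • y) • f (y + r • x)) (c • u) := by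
    intro u
    simp only
    rw [smul_smul, inv_mul_cancel₀ hc0.ne', one_smul]
  rw [integral_congr_ae (Filter.Eventually.of_forall h1), Measure.integral_comp_smul volume
    (fun y => gaussDensity d (c⁻¹ • y) • f (y + r • x)) c]
  rw [← integral_sub_right_eq_self _ (r • x), ← integral_smul]
  refine integral_congr_ae (Filter.Eventually.of_forall fun y => ?_)
  simp only [sub_add_cancel, smul_eq_mul, finrank_euclideanSpace_fin, mehler, gaussDensity]
  rw [abs_of_pos (by positivity), ← hc, ← hc2, norm_smul, Real.norm_eq_abs, abs_inv,
    abs_of_pos hc0, mul_pow, norm_sub_sq_real, inner_smul_right, norm_smul, mul_pow,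
    Real.norm_eq_abs, sq_abs, real_inner_comm]
  have : Real.exp (-((c⁻¹) ^ 2 * (‖y‖ ^ 2 - 2 * (r * inner ℝ x y) + r ^ 2 * ‖x‖ ^ 2))) =
      Real.exp (-‖y‖ ^ 2) *
      Real.exp ((2 * r * inner ℝ x y - r ^ 2 * ‖x‖ ^ 2 - r ^ 2 * ‖y‖ ^ 2) / c ^ 2) := by
    rw [← Real.exp_add]
    congr 1
    field_simp
    linear_combination (‖y‖ ^ 2) * hc2
  rw [this]
  ring

theorem ouSemigroup_eq {d : ℕ} {t : ℝ} (ht : 0 < t) (f : EuclideanSpace ℝ (Fin d) → ℝ)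
    (x : EuclideanSpace ℝ (Fin d)) :
    ouSemigroup t f x = ∫ y, mehler (Real.exp (-t)) x y * f y ∂(gaussianMeas d) := by
  have h : Real.exp (-2 * t) = Real.exp (-t) ^ 2 := by rw [← Real.exp_nat_mul]; ring_nf
  rw [ouSemigroup, h, integral_comp_affine_gaussianMeas]
  rw [← h, Real.exp_lt_one_iff]; linarith

theorem integral_mehler {d : ℕ} {r : ℝ} (hr : r ^ 2 < 1) (x : EuclideanSpace ℝ (Fin d)) :
    ∫ y, mehler r x y ∂(gaussianMeas d) = 1 := by
  have := integral_comp_affine_gaussianMeas hr (fun _ => 1) x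
  simpa using this.symm

theorem integrable_mehler {d : ℕ} {r : ℝ} (hr : r ^ 2 < 1) (x : EuclideanSpace ℝ (Fin d)) :
    Integrable (mehler r x) (gaussianMeas d) :=
  Integrable.of_integral_ne_zero (by rw [integral_mehler hr]; exact one_ne_zero)

theorem lintegral_mehler {d : ℕ} {r : ℝ} (hr : r ^ 2 < 1) (x : EuclideanSpace ℝ (Fin d)) :
    ∫⁻ y, ENNReal.ofReal (mehler r x y) ∂(gaussianMeas d) = 1 := by
  rw [← ofReal_integral_eq_lintegral_ofReal (integrable_mehler hr x)
    (Filter.Eventually.of_forall (mehler_nonneg r x)), integral_mehler hr, ENNReal.ofReal_one]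

theorem abs_exp_sub_one_le_mul_exp (z : ℝ) : |Real.exp z - 1| ≤ |z| * Real.exp |z| := by
  have h1 := Real.add_one_le_exp z
  have h2 := Real.add_one_le_exp (-z)
  have h3 : 1 ≤ Real.exp |z| := Real.one_le_exp (abs_nonneg z)
  have h4 : Real.exp z * Real.exp (-z) = 1 := by rw [← Real.exp_add]; simp
  rcases le_total 0 z with hz | hz
  · rw [abs_of_nonneg hz]
    rw [abs_of_nonneg (by linarith)]
    nlinarith [Real.exp_pos z]
  · rw [abs_of_nonpos (by rw [sub_nonpos, Real.exp_le_one_iff]; exact hz), abs_of_nonpos hz]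
    rw [abs_of_nonpos hz] at h3
    nlinarith

/-- The kernel is `e^z` with `|z| ≤ 2r(‖x‖² + ‖y‖² + d)`, once the normalising factor is put into
the exponent. In `|e^z - 1| ≤ |z| e^{|z|}` the factor `r` is kept; for small `r` everything else is
absorbed by Gaussians of arbitrarily small rate `c`. -/
theorem abs_mehler_sub_one_le {d : ℕ} {c : ℝ} (hc : 0 < c) : ∃ C r₀ : ℝ, 0 ≤ C ∧ 0 < r₀ ∧ r₀ < 1 ∧
    ∀ r, 0 ≤ r → r ≤ r₀ → ∀ x y : EuclideanSpace ℝ (Fin d),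
      |mehler r x y - 1| ≤ C * r * (Real.exp (c * ‖x‖ ^ 2) * Real.exp (c * ‖y‖ ^ 2)) := by
  refine ⟨4 / c * Real.exp (c * d), min (1 / 2) (c / 4), by positivity, by positivity,
    (min_le_left _ _).trans_lt (by norm_num), ?_⟩
  intro r hr0 hr x y
  have hr1 : r ≤ 1 / 2 := hr.trans (min_le_left _ _)
  have hr2 : r ≤ c / 4 := hr.trans (min_le_right _ _)
  have hs : 0 < 1 - r ^ 2 := by nlinarith
  have hsq : 0 < Real.sqrt (1 - r ^ 2) := Real.sqrt_pos.2 hs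
  set Q := (2 * r * inner ℝ x y - r ^ 2 * ‖x‖ ^ 2 - r ^ 2 * ‖y‖ ^ 2) / (1 - r ^ 2) with hQ
  set N := ‖x‖ ^ 2 + ‖y‖ ^ 2 + d with hN
  have hK : mehler r x y = Real.exp (Q + -(d * (Real.log (1 - r ^ 2) / 2))) := by
    rw [mehler, Real.exp_add, ← hQ, Real.exp_neg, ← Real.log_sqrt hs.le, Real.exp_nat_mul,
      Real.exp_log hsq, mul_comm]
  have hi := abs_real_inner_le_norm x y
  have hxy : |inner ℝ x y| ≤ (‖x‖ ^ 2 + ‖y‖ ^ 2) / 2 := by nlinarith [sq_nonneg (‖x‖ - ‖y‖)]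
  have hQb : |Q| ≤ 2 * r * (‖x‖ ^ 2 + ‖y‖ ^ 2) := by
    rw [hQ, abs_div, abs_of_pos hs, div_le_iff₀ hs]
    have a1 := abs_le.1 hxy
    have hN0 : 0 ≤ ‖x‖ ^ 2 + ‖y‖ ^ 2 := by positivity
    have e1 : r + r ^ 2 ≤ 2 * r * (1 - r ^ 2) := by nlinarith [mul_nonneg hr0 hr0]
    have e2 := mul_le_mul_of_nonneg_right e1 hN0
    have e3 := mul_le_mul_of_nonneg_left a1.1 hr0
    have e4 := mul_le_mul_of_nonneg_left a1.2 hr0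
    rw [abs_le]
    constructor <;> nlinarith [mul_nonneg hr0 (mul_nonneg hr0 hN0)]
  have hL : |-(d * (Real.log (1 - r ^ 2) / 2))| ≤ 2 * r * d := by
    have l1 : Real.log (1 - r ^ 2) ≤ 0 := Real.log_nonpos hs.le (by nlinarith)
    have l2 : -Real.log (1 - r ^ 2) ≤ r ^ 2 / (1 - r ^ 2) := by
      rw [← Real.log_inv]
      refine (Real.log_le_sub_one_of_pos (inv_pos.2 hs)).trans (le_of_eq ?_)
      field_simp
      ring
    have l3 : r ^ 2 / (1 - r ^ 2) ≤ 2 * r := by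
      rw [div_le_iff₀ hs]; nlinarith [mul_nonneg hr0 hr0]
    rw [abs_of_nonneg (by
      have := mul_nonneg (Nat.cast_nonneg (α := ℝ) d) (neg_nonneg.2 l1)
      linarith)]
    have := mul_le_mul_of_nonneg_left (l2.trans l3) (Nat.cast_nonneg (α := ℝ) d)
    have hd : 0 ≤ r * (d : ℝ) := by positivity
    linarith
  set z := Q + -(d * (Real.log (1 - r ^ 2) / 2)) with hz
  have hzb : |z| ≤ 2 * r * N := by
    refine (abs_add_le _ _).trans ?_
    rw [hN]; linarith
  have hN0 : 0 ≤ N := by positivity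
  rw [hK]
  calc |Real.exp z - 1| ≤ |z| * Real.exp |z| := abs_exp_sub_one_le_mul_exp z
    _ ≤ (2 * r * N) * Real.exp (2 * r * N) := by gcongr
    _ ≤ (2 * r * N) * Real.exp (c / 2 * N) := by gcongr; linarith
    _ ≤ (2 * r * (2 / c * Real.exp (c / 2 * N))) * Real.exp (c / 2 * N) := by
        gcongr
        rw [div_mul_eq_mul_div, le_div_iff₀ hc]
        have := Real.add_one_le_exp (c / 2 * N)
        linarith
    _ = 4 / c * r * (Real.exp (c / 2 * N) * Real.exp (c / 2 * N)) := by ring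
    _ = _ := by
        have : Real.exp (c / 2 * N) * Real.exp (c / 2 * N) =
            Real.exp (c * d) * (Real.exp (c * ‖x‖ ^ 2) * Real.exp (c * ‖y‖ ^ 2)) := by
          rw [← Real.exp_add, ← Real.exp_add, ← Real.exp_add, hN]
          ring_nf
        rw [this]
        ring

/-- Jensen's inequality for a weighted Lebesgue integral. -/
theorem lintegral_mul_rpow_le {α : Type*} [MeasurableSpace α] {μ : Measure α} {w g : α → ℝ≥0∞}
    (hw : AEMeasurable w μ) (hg : AEMeasurable g μ) {q : ℝ} (hq : 1 ≤ q) :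
    (∫⁻ a, w a * g a ∂μ) ^ q ≤ (∫⁻ a, w a ∂μ) ^ (q - 1) * ∫⁻ a, w a * g a ^ q ∂μ := by
  have hq0 : 0 < q := by linarith
  have hq1 : 1 / q ≤ 1 := by rw [div_le_one hq0]; exact hq
  -- Hölder with exponents `1 - 1/q` and `1/q` for the functions `w` and `w g^q`, whose weighted
  -- geometric mean is `w g`.
  have h := ENNReal.lintegral_mul_norm_pow_le (μ := μ) (p := 1 - 1 / q) (q := 1 / q) hw
    (hw.mul (hg.pow_const q)) (by linarith) (by positivity) (by ring)
  have e : ∀ a, w a ^ (1 - 1 / q) * (w a * g a ^ q) ^ (1 / q) = w a * g a := by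
    intro a
    rw [ENNReal.mul_rpow_of_nonneg _ _ (by positivity), ← mul_assoc,
      ← ENNReal.rpow_add_of_nonneg _ _ (by linarith) (by positivity), ← ENNReal.rpow_mul,
      mul_one_div_cancel hq0.ne']
    simp
  simp only [Pi.mul_apply, e] at h
  calc (∫⁻ a, w a * g a ∂μ) ^ q
      ≤ ((∫⁻ a, w a ∂μ) ^ (1 - 1 / q) * (∫⁻ a, w a * g a ^ q ∂μ) ^ (1 / q)) ^ q := by
        gcongr
    _ = _ := by
        rw [ENNReal.mul_rpow_of_nonneg _ _ hq0.le, ← ENNReal.rpow_mul, ← ENNReal.rpow_mul,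
          one_div_mul_cancel hq0.ne', ENNReal.rpow_one]
        congr 2
        field_simp

theorem measurable_integral_mehler {d : ℕ} {f : EuclideanSpace ℝ (Fin d) → ℝ}
    (hf : StronglyMeasurable f) : Measurable fun z : ℝ × EuclideanSpace ℝ (Fin d) =>
      ∫ y, mehler z.1 z.2 y * f y ∂(gaussianMeas d) := by
  refine StronglyMeasurable.measurable ?_
  refine StronglyMeasurable.integral_prod_right'
    (f := fun w : (ℝ × EuclideanSpace ℝ (Fin d)) × EuclideanSpace ℝ (Fin d) =>
      mehler w.1.1 w.1.2 w.2 * f w.2) ?_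
  refine Measurable.stronglyMeasurable (Measurable.mul ?_ (hf.measurable.comp measurable_snd))
  exact Measurable.mehler (by fun_prop) (by fun_prop) (by fun_prop)

/-- For fixed `x` the kernel is a probability density in `y`, so Jensen applies; after Tonelli,
symmetry makes it a probability density in `x` as well. -/
theorem eLpNorm_integral_mehler_le {d : ℕ} {p : ℝ≥0∞} (hp1 : 1 ≤ p) (hp : p ≠ ∞) {r : ℝ}
    (hr : r ^ 2 < 1) {f : EuclideanSpace ℝ (Fin d) → ℝ} (hf : StronglyMeasurable f) :
    eLpNorm (fun x => ∫ y, mehler r x y * f y ∂(gaussianMeas d)) p (gaussianMeas d) ≤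
      eLpNorm f p (gaussianMeas d) := by
  have hp0 : p ≠ 0 := (zero_lt_one.trans_le hp1).ne'
  have hpr : 1 ≤ p.toReal := by
    rw [← ENNReal.toReal_one]; exact ENNReal.toReal_mono hp hp1
  rw [eLpNorm_eq_lintegral_rpow_enorm_toReal hp0 hp, eLpNorm_eq_lintegral_rpow_enorm_toReal hp0 hp]
  gcongr 1
  have hKm : Measurable fun z : EuclideanSpace ℝ (Fin d) × EuclideanSpace ℝ (Fin d) =>
      mehler r z.1 z.2 := Measurable.mehler (by fun_prop) (by fun_prop) (by fun_prop)
  have hKx : ∀ x : EuclideanSpace ℝ (Fin d), Measurable (mehler r x) := fun x =>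
    Measurable.mehler (by fun_prop) (by fun_prop) (by fun_prop)
  calc ∫⁻ x, ‖∫ y, mehler r x y * f y ∂(gaussianMeas d)‖ₑ ^ p.toReal ∂(gaussianMeas d)
      ≤ ∫⁻ x, ∫⁻ y, ENNReal.ofReal (mehler r x y) * ‖f y‖ₑ ^ p.toReal ∂(gaussianMeas d)
          ∂(gaussianMeas d) := by
        refine lintegral_mono fun x => ?_
        calc ‖∫ y, mehler r x y * f y ∂(gaussianMeas d)‖ₑ ^ p.toReal
            ≤ (∫⁻ y, ENNReal.ofReal (mehler r x y) * ‖f y‖ₑ ∂(gaussianMeas d)) ^ p.toReal := by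
              gcongr
              refine (enorm_integral_le_lintegral_enorm _).trans (lintegral_mono fun y => ?_)
              rw [enorm_mul, Real.enorm_of_nonneg (mehler_nonneg r x y)]
          _ ≤ _ := by
              have := lintegral_mul_rpow_le (μ := gaussianMeas d) (w := fun y =>
                ENNReal.ofReal (mehler r x y)) (g := fun y => ‖f y‖ₑ)
                (hKx x).ennreal_ofReal.aemeasurable hf.enorm.aemeasurable hpr
              rwa [lintegral_mehler hr, ENNReal.one_rpow, one_mul] at this
    _ = ∫⁻ y, ∫⁻ x, ENNReal.ofReal (mehler r x y) * ‖f y‖ₑ ^ p.toReal ∂(gaussianMeas d)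
          ∂(gaussianMeas d) := by
        refine lintegral_lintegral_swap (Measurable.aemeasurable ?_)
        exact hKm.ennreal_ofReal.mul ((hf.enorm.comp measurable_snd).pow_const _)
    _ = ∫⁻ y, ‖f y‖ₑ ^ p.toReal ∂(gaussianMeas d) := by
        refine lintegral_congr fun y => ?_
        simp_rw [mehler_symm r _ y]
        rw [lintegral_mul_const _ (hKx y).ennreal_ofReal, lintegral_mehler hr, one_mul]

theorem integral_norm_le_norm_Lp {α : Type*} [MeasurableSpace α] {μ : Measure α}
    [IsProbabilityMeasure μ] {p : ℝ≥0∞} [hp1 : Fact (1 ≤ p)] (f : Lp ℝ p μ) :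
    Integrable f μ ∧ ∫ y, ‖f y‖ ∂μ ≤ ‖f‖ := by
  have hi : Integrable f μ := (Lp.memLp f).integrable hp1.out
  refine ⟨hi, ?_⟩
  rw [integral_norm_eq_lintegral_enorm hi.1, Lp.norm_def, ← eLpNorm_one_eq_lintegral_enorm]
  exact ENNReal.toReal_mono (Lp.eLpNorm_ne_top f)
    (eLpNorm_le_eLpNorm_of_exponent_le hp1.out hi.1)

theorem exists_clm_integral_mul {α : Type*} [MeasurableSpace α] {μ : Measure α}
    [IsProbabilityMeasure μ] {p : ℝ≥0∞} [Fact (1 ≤ p)] {k : α → ℝ} (hk : Measurable k) {A : ℝ}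
    (hA : ∀ y, |k y| ≤ A) :
    ∃ Φ : Lp ℝ p μ →L[ℝ] ℝ, (∀ f : Lp ℝ p μ, Φ f = ∫ y, k y * f y ∂μ) ∧
      ∀ f, ‖Φ f‖ ≤ A * ‖f‖ := by
  have hint : ∀ f : Lp ℝ p μ, Integrable (fun y => k y * f y) μ := fun f =>
    (integral_norm_le_norm_Lp f).1.bdd_mul hk.aestronglyMeasurable
      (Filter.Eventually.of_forall hA)
  have hb : ∀ f : Lp ℝ p μ, ‖∫ y, k y * f y ∂μ‖ ≤ A * ‖f‖ := by
    intro f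
    obtain ⟨i1, i2⟩ := integral_norm_le_norm_Lp f
    have hA0 : 0 ≤ A := by
      obtain ⟨y⟩ : Nonempty α := (inferInstance : (ae μ).NeBot).nonempty
      exact (abs_nonneg _).trans (hA y)
    calc ‖∫ y, k y * f y ∂μ‖ ≤ ∫ y, A * ‖f y‖ ∂μ := by
          refine norm_integral_le_of_norm_le (i1.norm.const_mul A)
            (Filter.Eventually.of_forall fun y => ?_)
          rw [norm_mul]
          gcongr
          exact hA y
      _ ≤ A * ‖f‖ := by rw [integral_const_mul]; gcongr
  refine ⟨LinearMap.mkContinuous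
    { toFun := fun f => ∫ y, k y * f y ∂μ
      map_add' := fun f g => ?_
      map_smul' := fun c f => ?_ } A hb, fun f => rfl, hb⟩
  · rw [← integral_add (hint f) (hint g)]
    refine integral_congr_ae ?_
    filter_upwards [Lp.coeFn_add f g] with y hy
    rw [hy, Pi.add_apply, mul_add]
  · rw [RingHom.id_apply, ← integral_smul]
    refine integral_congr_ae ?_
    filter_upwards [Lp.coeFn_smul c f] with y hy
    rw [hy, Pi.smul_apply, smul_eq_mul, smul_eq_mul]
    ring

/-! ### Mehler operators on `L^p` and convergence to the mean. -/

section MehlerOp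

variable {d : ℕ} {p : ℝ≥0∞} [Fact (1 ≤ p)]

/-- Evaluation of the Mehler integral at every single `x`, not just almost every one, is a
continuous functional of the class `f`. This yields linearity of the operators below and, later,
pointwise differentiation in time. -/
theorem exists_mehlerEval {r : ℝ} (hr : r ^ 2 < 1) (x : EuclideanSpace ℝ (Fin d)) :
    ∃ Φ : Lp ℝ p (gaussianMeas d) →L[ℝ] ℝ,
      (∀ f : Lp ℝ p (gaussianMeas d), Φ f = ∫ y, mehler r x y * f y ∂(gaussianMeas d)) ∧
      ∀ f, ‖Φ f‖ ≤ (Real.sqrt (1 - r ^ 2) ^ d)⁻¹ * Real.exp (‖x‖ ^ 2) * ‖f‖ := by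
  refine exists_clm_integral_mul ?_ fun y => ?_
  · exact Measurable.mehler (by fun_prop) (by fun_prop) (by fun_prop)
  · rw [abs_of_nonneg (mehler_nonneg r x y)]
    exact mehler_le hr x y

theorem exists_mehlerOp (hp : p ≠ ∞) {r : ℝ} (hr : r ^ 2 < 1) :
    ∃ M : Lp ℝ p (gaussianMeas d) →L[ℝ] Lp ℝ p (gaussianMeas d),
      (∀ f : Lp ℝ p (gaussianMeas d),
        M f =ᵐ[gaussianMeas d] fun x => ∫ y, mehler r x y * f y ∂(gaussianMeas d)) ∧
      ∀ f, ‖M f‖ ≤ 1 * ‖f‖ := by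
  have hle : ∀ f : Lp ℝ p (gaussianMeas d), eLpNorm (fun x => ∫ y, mehler r x y * f y
      ∂(gaussianMeas d)) p (gaussianMeas d) ≤ eLpNorm f p (gaussianMeas d) := fun f =>
    eLpNorm_integral_mehler_le Fact.out hp hr (Lp.stronglyMeasurable f)
  have hmem : ∀ f : Lp ℝ p (gaussianMeas d), MemLp (fun x => ∫ y, mehler r x y * f y
      ∂(gaussianMeas d)) p (gaussianMeas d) := fun f =>
    ⟨((measurable_integral_mehler (Lp.stronglyMeasurable f)).comp
      (measurable_prodMk_left (x := r))).aestronglyMeasurable,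
      (hle f).trans_lt (Lp.eLpNorm_lt_top f)⟩
  choose Φ hΦ _ using fun x : EuclideanSpace ℝ (Fin d) => exists_mehlerEval (p := p) hr x
  have hb : ∀ f : Lp ℝ p (gaussianMeas d), ‖(hmem f).toLp _‖ ≤ 1 * ‖f‖ := by
    intro f
    rw [Lp.norm_toLp, one_mul, Lp.norm_def]
    exact ENNReal.toReal_mono (Lp.eLpNorm_ne_top f) (hle f)
  refine ⟨LinearMap.mkContinuous
    { toFun := fun f => (hmem f).toLp _
      map_add' := fun f g => ?_
      map_smul' := fun c f => ?_ } 1 hb, fun f => (hmem f).coeFn_toLp, hb⟩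
  · rw [← MemLp.toLp_add]
    refine MemLp.toLp_congr _ _ (Filter.Eventually.of_forall fun x => ?_)
    simp only [Pi.add_apply, ← hΦ, map_add]
  · rw [RingHom.id_apply, ← MemLp.toLp_const_smul]
    refine MemLp.toLp_congr _ _ (Filter.Eventually.of_forall fun x => ?_)
    simp only [Pi.smul_apply, ← hΦ, map_smul]

variable (d p) in
open Classical in
/-- The Mehler operator `f ↦ ∫ f(√(1 - r²) u + r x) γ(du)` on `L^p(γ)`; the identity when
`r² ≥ 1`. -/
noncomputable def mehlerOp (r : ℝ) : Lp ℝ p (gaussianMeas d) →L[ℝ] Lp ℝ p (gaussianMeas d) :=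
  if h : p ≠ ∞ ∧ r ^ 2 < 1 then (exists_mehlerOp h.1 h.2).choose
  else ContinuousLinearMap.id ℝ _

theorem mehlerOp_one : mehlerOp d p 1 = ContinuousLinearMap.id ℝ _ := by
  rw [mehlerOp, dif_neg (by norm_num)]

theorem mehlerOp_ae (hp : p ≠ ∞) {r : ℝ} (hr : r ^ 2 < 1) (f : Lp ℝ p (gaussianMeas d)) :
    mehlerOp d p r f =ᵐ[gaussianMeas d] fun x => ∫ y, mehler r x y * f y ∂(gaussianMeas d) := by
  have h : p ≠ ∞ ∧ r ^ 2 < 1 := ⟨hp, hr⟩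
  rw [mehlerOp, dif_pos h]
  exact (exists_mehlerOp h.1 h.2).choose_spec.1 f

theorem norm_mehlerOp_apply_le (r : ℝ) (f : Lp ℝ p (gaussianMeas d)) :
    ‖mehlerOp d p r f‖ ≤ ‖f‖ := by
  rw [mehlerOp]
  split_ifs with h
  · simpa using (exists_mehlerOp h.1 h.2).choose_spec.2 f
  · simp

/-- Exponential convergence to equilibrium in `L^p`, `1 < p < ∞`. -/
theorem exists_norm_mehlerOp_sub_le (hp1 : 1 < p) (hp : p ≠ ∞) : ∃ C : ℝ, 0 ≤ C ∧
    ∀ r, 0 ≤ r → r ≤ 1 → ∀ f : Lp ℝ p (gaussianMeas d),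
      ‖mehlerOp d p r f - mehlerOp d p 0 f‖ ≤ C * r * ‖f‖ := by
  have hpr : 1 < p.toReal := by
    rw [← ENNReal.toReal_one, ENNReal.toReal_lt_toReal ENNReal.one_ne_top hp]; exact hp1
  set p' := p.toReal.conjExponent with hp'
  have hconj : p.toReal.HolderConjugate p' := Real.HolderConjugate.conjExponent hpr
  have hp'1 : 1 < p' := hconj.symm.lt
  -- This rate gives `c p < 1` and `c p' < 1`, so `e^{c‖x‖²}` lies in both `L^p` and `L^{p'}`.
  set c : ℝ := 1 / (2 * (p.toReal + p')) with hc
  have hc0 : 0 < c := by positivity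
  obtain ⟨C, r₀, hC, hr₀, hr₀1, hK⟩ := abs_mehler_sub_one_le (d := d) hc0
  have hcp : c * p.toReal < 1 := by
    rw [hc, div_mul_eq_mul_div, div_lt_one (by positivity)]; linarith
  have hcp' : c * p' < 1 := by
    rw [hc, div_mul_eq_mul_div, div_lt_one (by positivity)]; linarith
  have hcont : Continuous fun x : EuclideanSpace ℝ (Fin d) => Real.exp (c * ‖x‖ ^ 2) := by fun_prop
  have hE : MemLp (fun x : EuclideanSpace ℝ (Fin d) => Real.exp (c * ‖x‖ ^ 2)) p
      (gaussianMeas d) :=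
    memLp_of_le_exp (c := c) hp hcont.aestronglyMeasurable hcp 1 fun x => by simp
  have hE' : MemLp (fun x : EuclideanSpace ℝ (Fin d) => Real.exp (c * ‖x‖ ^ 2))
      (ENNReal.ofReal p') (gaussianMeas d) := by
    refine memLp_of_le_exp (c := c) ENNReal.ofReal_ne_top hcont.aestronglyMeasurable ?_ 1
      fun x => by simp
    rwa [ENNReal.toReal_ofReal (by positivity)]
  set A := (eLpNorm (fun x : EuclideanSpace ℝ (Fin d) => Real.exp (c * ‖x‖ ^ 2))
      (ENNReal.ofReal p') (gaussianMeas d)).toReal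
  set B := (eLpNorm (fun x : EuclideanSpace ℝ (Fin d) => Real.exp (c * ‖x‖ ^ 2)) p
      (gaussianMeas d)).toReal
  have hconj' : ENNReal.HolderConjugate (ENNReal.ofReal p') p := by
    rw [← ENNReal.ofReal_toReal hp]
    have := hconj.symm
    exact Real.HolderConjugate.ennrealOfReal this
  have hH : ∀ f : Lp ℝ p (gaussianMeas d),
      Integrable (fun y => Real.exp (c * ‖y‖ ^ 2) * f y) (gaussianMeas d) ∧
      ∫ y, |Real.exp (c * ‖y‖ ^ 2) * f y| ∂(gaussianMeas d) ≤ A * ‖f‖ := by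
    intro f
    have hi : Integrable (fun y => Real.exp (c * ‖y‖ ^ 2) * f y) (gaussianMeas d) :=
      MemLp.integrable_mul hE' (Lp.memLp f)
    refine ⟨hi, ?_⟩
    have := eLpNorm_smul_le_mul_eLpNorm (p := ENNReal.ofReal p') (q := p) (r := 1)
      (Lp.aestronglyMeasurable f) hE'.1
    simp only [← Real.norm_eq_abs]
    rw [integral_norm_eq_lintegral_enorm hi.1, Lp.norm_def, ← eLpNorm_one_eq_lintegral_enorm,
      ← ENNReal.toReal_mul]
    exact ENNReal.toReal_mono (ENNReal.mul_ne_top hE'.2.ne (Lp.eLpNorm_ne_top f)) this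
  refine ⟨max (2 / r₀) (C * A * B), by positivity, fun r hr0 hr1 f => ?_⟩
  -- Away from `r = 0` contractivity suffices, as `2 ≤ (2/r₀) r`. Near `0` the kernel estimate is
  -- used, with Hölder in `y` against the `L^{p'}` weight and the `L^p` norm of the weight in `x`.
  rcases le_total r₀ r with h | h
  · calc ‖mehlerOp d p r f - mehlerOp d p 0 f‖ ≤ ‖f‖ + ‖f‖ :=
          (norm_sub_le _ _).trans (add_le_add (norm_mehlerOp_apply_le _ _)
            (norm_mehlerOp_apply_le _ _))
      _ ≤ 2 / r₀ * r * ‖f‖ := by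
          rw [← two_mul]
          gcongr
          rw [div_mul_eq_mul_div, le_div_iff₀ hr₀]
          linarith
      _ ≤ _ := by gcongr; exact le_max_left _ _
  · have hr2 : r ^ 2 < 1 := by nlinarith
    have hbd : ∀ᵐ x ∂(gaussianMeas d), ‖(mehlerOp d p r f - mehlerOp d p 0 f) x‖ ≤
        (C * r * (A * ‖f‖)) * ‖Real.exp (c * ‖x‖ ^ 2)‖ := by
      filter_upwards [mehlerOp_ae hp hr2 f, mehlerOp_ae hp (r := 0) (by norm_num) f,
        Lp.coeFn_sub (mehlerOp d p r f) (mehlerOp d p 0 f)] with x h1 h2 h3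
      obtain ⟨i1, i2⟩ := hH f
      have hif := (integral_norm_le_norm_Lp f).1
      have hm : Measurable (mehler r x) :=
        Measurable.mehler (by fun_prop) (by fun_prop) (by fun_prop)
      have i3 : Integrable (fun y => mehler r x y * f y) (gaussianMeas d) :=
        hif.bdd_mul hm.aestronglyMeasurable (Filter.Eventually.of_forall fun y => by
          rw [Real.norm_of_nonneg (mehler_nonneg r x y)]
          exact mehler_le hr2 x y)
      have h0 : ∀ y : EuclideanSpace ℝ (Fin d), mehler 0 x y = 1 := by intro y; simp [mehler]
      rw [h3, Pi.sub_apply, h1, h2]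
      simp only [h0, one_mul]
      rw [← integral_sub i3 hif, Real.norm_eq_abs (Real.exp _), Real.abs_exp]
      calc ‖∫ y, (mehler r x y * f y - f y) ∂(gaussianMeas d)‖
          ≤ ∫ y, C * r * Real.exp (c * ‖x‖ ^ 2) * |Real.exp (c * ‖y‖ ^ 2) * f y|
              ∂(gaussianMeas d) := by
            refine norm_integral_le_of_norm_le (i1.abs.const_mul _)
              (Filter.Eventually.of_forall fun y => ?_)
            rw [← sub_one_mul, norm_mul, abs_mul, Real.abs_exp]
            calc _ ≤ (C * r * (Real.exp (c * ‖x‖ ^ 2) * Real.exp (c * ‖y‖ ^ 2))) * |f y| := by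
                  rw [Real.norm_eq_abs, Real.norm_eq_abs]
                  gcongr
                  exact hK r hr0 h x y
              _ = _ := by ring
        _ ≤ C * r * Real.exp (c * ‖x‖ ^ 2) * (A * ‖f‖) := by
            rw [integral_const_mul]; gcongr
        _ = _ := by ring
    calc ‖mehlerOp d p r f - mehlerOp d p 0 f‖ ≤ (C * r * (A * ‖f‖)) * B := by
          rw [Lp.norm_def]
          have hA0 : 0 ≤ C * r * (A * ‖f‖) := by positivity
          have := eLpNorm_le_mul_eLpNorm_of_ae_le_mul hbd p
          refine (ENNReal.toReal_mono (ENNReal.mul_ne_top ENNReal.ofReal_ne_top hE.2.ne)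
            this).trans ?_
          rw [ENNReal.toReal_mul, ENNReal.toReal_ofReal hA0]
      _ = C * A * B * r * ‖f‖ := by ring
      _ ≤ _ := by gcongr; exact le_max_right _ _

end MehlerOp

/-! ### Polynomial functions and Hermite eigenfunctions. -/

/-- Continuous functions on `ℝ^d` growing slower than every Gaussian `e^{c|x|²}`. -/
def subgaussianGrowth (d : ℕ) : Subalgebra ℝ (EuclideanSpace ℝ (Fin d) → ℝ) where
  carrier := {f | Continuous f ∧
    ∀ c : ℝ, 0 < c → ∃ A, 0 ≤ A ∧ ∀ x, |f x| ≤ A * Real.exp (c * ‖x‖ ^ 2)}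
  mul_mem' := by
    rintro f g ⟨hf, hf'⟩ ⟨hg, hg'⟩
    refine ⟨hf.mul hg, fun c hc => ?_⟩
    obtain ⟨A, hA, hfA⟩ := hf' (c / 2) (by positivity)
    obtain ⟨B, hB, hgB⟩ := hg' (c / 2) (by positivity)
    refine ⟨A * B, by positivity, fun x => ?_⟩
    rw [Pi.mul_apply, abs_mul]
    calc |f x| * |g x| ≤ (A * Real.exp (c / 2 * ‖x‖ ^ 2)) * (B * Real.exp (c / 2 * ‖x‖ ^ 2)) := by
          gcongr
          · exact hfA x
          · exact hgB x
      _ = A * B * (Real.exp (c / 2 * ‖x‖ ^ 2) * Real.exp (c / 2 * ‖x‖ ^ 2)) := by ring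
      _ = _ := by rw [← Real.exp_add]; ring_nf
  add_mem' := by
    rintro f g ⟨hf, hf'⟩ ⟨hg, hg'⟩
    refine ⟨hf.add hg, fun c hc => ?_⟩
    obtain ⟨A, hA, hfA⟩ := hf' c hc
    obtain ⟨B, hB, hgB⟩ := hg' c hc
    refine ⟨A + B, by positivity, fun x => ?_⟩
    rw [Pi.add_apply, add_mul]
    exact (abs_add_le _ _).trans (add_le_add (hfA x) (hgB x))
  algebraMap_mem' a := by
    refine ⟨continuous_const, fun c hc => ⟨|a|, abs_nonneg _, fun x => ?_⟩⟩
    exact le_mul_of_one_le_right (abs_nonneg a) (Real.one_le_exp (by positivity))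

/-- The algebra of polynomial functions on `ℝ^d`. -/
def polyFunctions (d : ℕ) : Subalgebra ℝ (EuclideanSpace ℝ (Fin d) → ℝ) :=
  Algebra.adjoin ℝ (Set.range fun (i : Fin d) (x : EuclideanSpace ℝ (Fin d)) => x i)

theorem coord_mem_polyFunctions {d : ℕ} (i : Fin d) :
    (fun x : EuclideanSpace ℝ (Fin d) => x i) ∈ polyFunctions d :=
  Algebra.subset_adjoin ⟨i, rfl⟩

theorem norm_sq_mem_polyFunctions (d : ℕ) :
    (fun x : EuclideanSpace ℝ (Fin d) => ‖x‖ ^ 2) ∈ polyFunctions d := by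
  have : (fun x : EuclideanSpace ℝ (Fin d) => ‖x‖ ^ 2) =
      ∑ i, (fun x : EuclideanSpace ℝ (Fin d) => x i) ^ 2 := by
    ext x
    simp [EuclideanSpace.norm_sq_eq]
  rw [this]
  exact sum_mem fun i _ => pow_mem (coord_mem_polyFunctions i) 2

theorem polyFunctions_le_subgaussianGrowth (d : ℕ) : polyFunctions d ≤ subgaussianGrowth d := by
  refine Algebra.adjoin_le ?_
  rintro _ ⟨i, rfl⟩
  refine ⟨by fun_prop, fun c hc => ⟨1 + 1 / c, by positivity, fun x => ?_⟩⟩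
  have h1 : |x i| ≤ ‖x‖ := by simpa using PiLp.norm_apply_le x i
  have h2 : ‖x‖ ≤ 1 + ‖x‖ ^ 2 := by nlinarith [sq_nonneg (‖x‖ - 1)]
  have h3 := Real.add_one_le_exp (c * ‖x‖ ^ 2)
  have h5 : ‖x‖ ^ 2 ≤ 1 / c * Real.exp (c * ‖x‖ ^ 2) := by
    rw [div_mul_eq_mul_div, le_div_iff₀ hc]; linarith
  have h4 : 1 ≤ Real.exp (c * ‖x‖ ^ 2) := Real.one_le_exp (by positivity)
  rw [add_mul]
  linarith

theorem polynomial_eval_coord_mem {d : ℕ} (P : Polynomial ℝ) (i : Fin d) :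
    (fun x : EuclideanSpace ℝ (Fin d) => P.eval (x i)) ∈ polyFunctions d := by
  induction P using Polynomial.induction_on' with
  | add p q hp hq => simpa [Pi.add_def] using add_mem hp hq
  | monomial n a =>
    have := (polyFunctions d).smul_mem (pow_mem (coord_mem_polyFunctions i) n) a
    convert this using 1
    ext x
    simp

theorem hermiteFun_mem_polyFunctions {d : ℕ} (ν : Fin d → ℕ) : hermiteFun ν ∈ polyFunctions d := by
  have h : hermiteFun ν =
      (Real.sqrt ((2 : ℝ) ^ (∑ i, ν i) * ∏ i, ((ν i).factorial : ℝ)))⁻¹ •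
      ∏ i, fun x : EuclideanSpace ℝ (Fin d) => (physHermite (ν i)).eval (x i) := by
    ext x
    rw [hermiteFun_eq]
    simp
  rw [h]
  exact (polyFunctions d).smul_mem (prod_mem fun i _ => polynomial_eval_coord_mem _ i) _

theorem prod_physHermite_mem_span {d : ℕ} (ν : Fin d → ℕ) :
    (fun x : EuclideanSpace ℝ (Fin d) => ∏ i, (physHermite (ν i)).eval (x i)) ∈
      Submodule.span ℝ (Set.range (hermiteFun (d := d))) := by
  have hs : 0 < Real.sqrt ((2 : ℝ) ^ (∑ i, ν i) * ∏ i, ((ν i).factorial : ℝ)) := by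
    refine Real.sqrt_pos.2 (mul_pos (by positivity) (Finset.prod_pos fun i _ => ?_))
    exact_mod_cast Nat.factorial_pos _
  have h : (fun x : EuclideanSpace ℝ (Fin d) => ∏ i, (physHermite (ν i)).eval (x i)) =
      Real.sqrt ((2 : ℝ) ^ (∑ i, ν i) * ∏ i, ((ν i).factorial : ℝ)) • hermiteFun ν := by
    ext x
    rw [Pi.smul_apply, hermiteFun_eq, smul_eq_mul, mul_inv_cancel_left₀ hs.ne']
  rw [h]
  exact Submodule.smul_mem _ _ (Submodule.subset_span ⟨ν, rfl⟩)

/-- The recurrence `y H_n = H_{n+1}/2 + n H_{n-1}` in the variable `x_j`. The case `ν j = 0` is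
separate because the second term is absent. -/
theorem coord_mul_prod_physHermite_mem_span {d : ℕ} (ν : Fin d → ℕ) (j : Fin d) :
    (fun x : EuclideanSpace ℝ (Fin d) => x j * ∏ i, (physHermite (ν i)).eval (x i)) ∈
      Submodule.span ℝ (Set.range (hermiteFun (d := d))) := by
  have hprod : ∀ (n : ℕ) (x : EuclideanSpace ℝ (Fin d)),
      ∏ i, (physHermite (Function.update ν j n i)).eval (x i) =
      (physHermite n).eval (x j) * ∏ i ∈ Finset.univ.erase j, (physHermite (ν i)).eval (x i) := by
    intro n x
    rw [← Finset.mul_prod_erase _ _ (Finset.mem_univ j), Function.update_self]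
    congr 1
    refine Finset.prod_congr rfl fun i hi => ?_
    rw [Function.update_of_ne (Finset.ne_of_mem_erase hi)]
  have hν : ∀ x : EuclideanSpace ℝ (Fin d), ∏ i, (physHermite (ν i)).eval (x i) =
      (physHermite (ν j)).eval (x j) *
        ∏ i ∈ Finset.univ.erase j, (physHermite (ν i)).eval (x i) := by
    intro x
    rw [← hprod, Function.update_eq_self]
  have m1 := prod_physHermite_mem_span (Function.update ν j (ν j + 1))
  rcases hn : ν j with _ | n
  · have : (fun x : EuclideanSpace ℝ (Fin d) => x j * ∏ i, (physHermite (ν i)).eval (x i)) =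
        (1 / 2 : ℝ) • fun x : EuclideanSpace ℝ (Fin d) =>
          ∏ i, (physHermite (Function.update ν j (ν j + 1) i)).eval (x i) := by
      ext x
      rw [Pi.smul_apply, hprod, hν, hn]
      simp [physHermite]
      ring
    rw [this]
    exact Submodule.smul_mem _ _ m1
  · have m2 := prod_physHermite_mem_span (Function.update ν j n)
    have : (fun x : EuclideanSpace ℝ (Fin d) => x j * ∏ i, (physHermite (ν i)).eval (x i)) =
        (1 / 2 : ℝ) • (fun x : EuclideanSpace ℝ (Fin d) =>
          ∏ i, (physHermite (Function.update ν j (ν j + 1) i)).eval (x i)) +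
        ((n : ℝ) + 1) • fun x : EuclideanSpace ℝ (Fin d) =>
          ∏ i, (physHermite (Function.update ν j n i)).eval (x i) := by
      ext x
      rw [Pi.add_apply, Pi.smul_apply, Pi.smul_apply, hprod, hprod, hν, hn,
        physHermite_succ_succ]
      simp
      ring
    rw [this]
    exact Submodule.add_mem _ (Submodule.smul_mem _ _ m1) (Submodule.smul_mem _ _ m2)

theorem polyFunctions_le_span_hermiteFun {d : ℕ} {f : EuclideanSpace ℝ (Fin d) → ℝ}
    (hf : f ∈ polyFunctions d) : f ∈ Submodule.span ℝ (Set.range (hermiteFun (d := d))) := by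
  -- The span is not visibly closed under products, so the induction shows instead that `f`
  -- multiplies the span into itself; applying this to `1` finishes.
  have key : ∀ g ∈ Submodule.span ℝ (Set.range (hermiteFun (d := d))),
      f * g ∈ Submodule.span ℝ (Set.range (hermiteFun (d := d))) := by
    induction hf using Algebra.adjoin_induction with
    | mem f hf =>
      obtain ⟨j, rfl⟩ := hf
      intro g hg
      induction hg using Submodule.span_induction with
      | mem g hg =>
        obtain ⟨ν, rfl⟩ := hg
        have : (fun x : EuclideanSpace ℝ (Fin d) => x j) * hermiteFun ν =
          (Real.sqrt ((2 : ℝ) ^ (∑ i, ν i) * ∏ i, ((ν i).factorial : ℝ)))⁻¹ •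
          fun x : EuclideanSpace ℝ (Fin d) => x j * ∏ i, (physHermite (ν i)).eval (x i) := by
          ext x
          rw [Pi.mul_apply, Pi.smul_apply, hermiteFun_eq, smul_eq_mul]
          ring
        rw [this]
        exact Submodule.smul_mem _ _ (coord_mul_prod_physHermite_mem_span ν j)
      | zero => simp
      | add g h _ _ hg hh => rw [mul_add]; exact Submodule.add_mem _ hg hh
      | smul a g _ hg => rw [mul_smul_comm]; exact Submodule.smul_mem _ _ hg
    | algebraMap a =>
      intro g hg
      rw [← Algebra.smul_def]
      exact Submodule.smul_mem _ _ hg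
    | add f₁ f₂ _ _ h₁ h₂ =>
      intro g hg
      rw [add_mul]
      exact Submodule.add_mem _ (h₁ g hg) (h₂ g hg)
    | mul f₁ f₂ _ _ h₁ h₂ =>
      intro g hg
      rw [mul_assoc]
      exact h₁ _ (h₂ g hg)
  have h1 : (1 : EuclideanSpace ℝ (Fin d) → ℝ) ∈
      Submodule.span ℝ (Set.range (hermiteFun (d := d))) := by
    have := prod_physHermite_mem_span (0 : Fin d → ℕ)
    simpa [physHermite, Pi.one_def] using this
  simpa using key 1 h1

theorem memLp_of_mem_subgaussianGrowth {d : ℕ} {p : ℝ≥0∞} (hp : p ≠ ∞)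
    {f : EuclideanSpace ℝ (Fin d) → ℝ} (hf : f ∈ subgaussianGrowth d) :
    MemLp f p (gaussianMeas d) := by
  have hp0 : 0 ≤ p.toReal := ENNReal.toReal_nonneg
  obtain ⟨A, _, hA⟩ := hf.2 (1 / (p.toReal + 1)) (by positivity)
  refine memLp_of_le_exp hp hf.1.aestronglyMeasurable ?_ A hA
  rw [div_mul_eq_mul_div, div_lt_one (by positivity)]
  linarith

theorem memLp_hermiteFun {d : ℕ} {p : ℝ≥0∞} (hp : p ≠ ∞) (ν : Fin d → ℕ) :
    MemLp (hermiteFun ν) p (gaussianMeas d) :=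
  memLp_of_mem_subgaussianGrowth hp
    (polyFunctions_le_subgaussianGrowth d (hermiteFun_mem_polyFunctions ν))

/-- The normalized Hermite polynomial as an element of `L^p`. -/
noncomputable def hermiteLp {d : ℕ} {p : ℝ≥0∞} (hp : p ≠ ∞) (ν : Fin d → ℕ) :
    Lp ℝ p (gaussianMeas d) :=
  (memLp_hermiteFun hp ν).toLp (hermiteFun ν)

/-- In the affine form of the Mehler integral the integrand is a product over coordinates, so the
integral factors into one-dimensional Mehler formulas. -/
theorem integral_mehler_hermiteFun {d : ℕ} {r : ℝ} (hr : r ^ 2 < 1) (ν : Fin d → ℕ)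
    (x : EuclideanSpace ℝ (Fin d)) :
    ∫ y, mehler r x y * hermiteFun ν y ∂(gaussianMeas d) = r ^ (∑ i, ν i) * hermiteFun ν x := by
  rw [← integral_comp_affine_gaussianMeas hr]
  simp only [hermiteFun_eq, PiLp.add_apply, PiLp.smul_apply, smul_eq_mul]
  rw [integral_const_mul, integral_prod_gaussianMeas fun i v =>
    (physHermite (ν i)).eval (Real.sqrt (1 - r ^ 2) * v + r * x i)]
  rw [mul_left_comm, ← Finset.prod_pow_eq_pow_sum Finset.univ ν r, ← Finset.prod_mul_distrib]
  congr 1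
  refine Finset.prod_congr rfl fun i _ => ?_
  rw [integral_physHermite_comp _ _ (by rw [Real.sq_sqrt (by linarith)]; ring),
    inv_mul_cancel_left₀ (Real.sqrt_pos.2 Real.pi_pos).ne']

theorem mehlerOp_hermiteLp {d : ℕ} {p : ℝ≥0∞} [Fact (1 ≤ p)] (hp : p ≠ ∞) {r : ℝ} (h0 : 0 ≤ r)
    (h1 : r ≤ 1) (ν : Fin d → ℕ) :
    mehlerOp d p r (hermiteLp hp ν) = r ^ (∑ i, ν i) • hermiteLp hp ν := by
  rcases h1.eq_or_lt with rfl | h1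
  · simp [mehlerOp_one]
  have hr : r ^ 2 < 1 := by nlinarith
  refine Lp.ext ?_
  filter_upwards [mehlerOp_ae hp hr (hermiteLp hp ν), (memLp_hermiteFun hp ν).coeFn_toLp,
    Lp.coeFn_smul (r ^ (∑ i, ν i)) (hermiteLp hp ν)] with x e1 e2 e3
  rw [e1, e3, Pi.smul_apply, smul_eq_mul, hermiteLp, e2, ← integral_mehler_hermiteFun hr]
  refine integral_congr_ae ?_
  filter_upwards [(memLp_hermiteFun hp ν).coeFn_toLp] with y hy
  rw [hy]

/-! ### Density of the Hermite polynomials in `L^p`. -/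

section Density

variable {d : ℕ} {p : ℝ≥0∞} [Fact (1 ≤ p)]

theorem tendsto_toLp_of_dominated {α : Type*} [MeasurableSpace α] {μ : Measure α}
    (hp : p ≠ ∞) {F : ℕ → α → ℝ} {f G : α → ℝ}
    (hF : ∀ n, MemLp (F n) p μ) (hf : MemLp f p μ) (hG : MemLp G p μ)
    (hb : ∀ n x, |F n x| ≤ G x)
    (hlim : ∀ x, Filter.Tendsto (fun n => F n x) Filter.atTop (nhds (f x))) :
    Filter.Tendsto (fun n => (hF n).toLp (F n)) Filter.atTop (nhds (hf.toLp f)) := by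
  have hp1 : 1 ≤ p := Fact.out
  have hp0 : p ≠ 0 := (zero_lt_one.trans_le hp1).ne'
  have hpr : 0 < p.toReal := ENNReal.toReal_pos hp0 hp
  rw [Lp.tendsto_Lp_iff_tendsto_eLpNorm'']
  have hfb : ∀ x, |f x| ≤ G x := fun x =>
    le_of_tendsto (hlim x).abs (Filter.Eventually.of_forall fun n => hb n x)
  have h1 : Filter.Tendsto (fun n => ∫⁻ x, ‖(F n - f) x‖ₑ ^ p.toReal ∂μ) Filter.atTop
      (nhds (∫⁻ _, 0 ∂μ)) := by
    refine tendsto_lintegral_of_dominated_convergence' (fun x => ‖(2 : ℝ) * G x‖ₑ ^ p.toReal)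
      (fun n => (((hF n).1.sub hf.1).enorm.pow_const _)) (fun n => ?_) ?_ ?_
    · refine Filter.Eventually.of_forall fun x => ?_
      dsimp only
      gcongr
      rw [enorm_le_iff_norm_le, Pi.sub_apply, Real.norm_eq_abs, Real.norm_eq_abs]
      refine (abs_sub _ _).trans (le_trans ?_ (le_abs_self _))
      linarith [hb n x, hfb x]
    · exact ((lintegral_rpow_enorm_lt_top_of_eLpNorm_lt_top hp0 hp
        (hG.const_mul 2).2)).ne
    · refine Filter.Eventually.of_forall fun x => ?_
      have h2 : Filter.Tendsto (fun n => ‖(F n - f) x‖ₑ) Filter.atTop (nhds ‖(0 : ℝ)‖ₑ) := by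
        refine (continuous_enorm.tendsto _).comp ?_
        simpa using (hlim x).sub_const (f x)
      have := h2.ennrpow_const p.toReal
      simpa [ENNReal.zero_rpow_of_pos hpr] using this
  simp only [lintegral_zero] at h1
  have h3 := h1.ennrpow_const (1 / p.toReal)
  rw [ENNReal.zero_rpow_of_pos (by positivity)] at h3
  refine h3.congr fun n => ?_
  rw [eLpNorm_eq_lintegral_rpow_enorm_toReal hp0 hp]

/-- Functions whose class lies in the closed span of the Hermite polynomials in `L^p`. -/
def hermiteClosure (d : ℕ) (p : ℝ≥0∞) [Fact (1 ≤ p)] (hp : p ≠ ∞) :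
    Submodule ℝ (EuclideanSpace ℝ (Fin d) → ℝ) where
  carrier := {f | ∃ h : MemLp f p (gaussianMeas d),
    h.toLp f ∈ (Submodule.span ℝ (Set.range (hermiteLp (d := d) hp))).topologicalClosure}
  add_mem' := by
    rintro f g ⟨hf, hf'⟩ ⟨hg, hg'⟩
    exact ⟨hf.add hg, by rw [MemLp.toLp_add hf hg]; exact Submodule.add_mem _ hf' hg'⟩
  zero_mem' := ⟨MemLp.zero, by rw [MemLp.toLp_zero]; exact Submodule.zero_mem _⟩
  smul_mem' := by
    rintro a f ⟨hf, hf'⟩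
    exact ⟨hf.const_smul a, by rw [MemLp.toLp_const_smul a hf]; exact Submodule.smul_mem _ _ hf'⟩

theorem polyFunctions_subset_hermiteClosure (hp : p ≠ ∞) {f : EuclideanSpace ℝ (Fin d) → ℝ}
    (hf : f ∈ polyFunctions d) : f ∈ hermiteClosure d p hp := by
  refine (Submodule.span_le.2 ?_ : _ ≤ hermiteClosure d p hp) (polyFunctions_le_span_hermiteFun hf)
  rintro _ ⟨ν, rfl⟩
  exact ⟨memLp_hermiteFun hp ν,
    Submodule.le_topologicalClosure _ (Submodule.subset_span ⟨ν, rfl⟩)⟩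

theorem abs_sum_exp_le (z : ℝ) (N : ℕ) :
    |∑ j ∈ Finset.range N, z ^ j / (j.factorial : ℝ)| ≤ Real.exp |z| := by
  refine (Finset.abs_sum_le_sum_abs _ _).trans ?_
  refine le_trans (le_of_eq ?_) (Real.sum_le_exp_of_nonneg (abs_nonneg z) N)
  refine Finset.sum_congr rfl fun j _ => ?_
  rw [abs_div, abs_pow, Nat.abs_cast]

/-- One Gaussian factor at a time is replaced by its Taylor sums, which are polynomials bounded by
`e^{ε‖x‖²}`. The remaining factors are at most `1`, so `2εp < 1` permits dominated convergence for
every `n`. -/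
theorem poly_mul_gaussian_mem_hermiteClosure (hp : p ≠ ∞) {ε : ℝ} (hε : 0 < ε)
    (hεp : 2 * ε * p.toReal < 1) (n : ℕ) : ∀ f ∈ polyFunctions d,
      (f * fun x => Real.exp (-ε * ‖x‖ ^ 2) ^ n) ∈ hermiteClosure d p hp := by
  induction n with
  | zero =>
    intro f hf
    simpa [Pi.one_def, Pi.mul_def] using polyFunctions_subset_hermiteClosure hp hf
  | succ n ih =>
    intro f hf
    obtain ⟨hfc, hfg⟩ := polyFunctions_le_subgaussianGrowth d hf
    obtain ⟨A, hA, hfA⟩ := hfg ε hε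
    set S : ℕ → EuclideanSpace ℝ (Fin d) → ℝ := fun N x =>
      ∑ j ∈ Finset.range N, (-ε * ‖x‖ ^ 2) ^ j / (j.factorial : ℝ) with hS
    have hSm : ∀ N, S N ∈ polyFunctions d := by
      intro N
      have : S N = ∑ j ∈ Finset.range N, ((j.factorial : ℝ)⁻¹ * (-ε) ^ j) •
          (fun x : EuclideanSpace ℝ (Fin d) => ‖x‖ ^ 2) ^ j := by
        ext x
        simp only [hS, Finset.sum_apply, Pi.smul_apply, Pi.pow_apply, smul_eq_mul]
        refine Finset.sum_congr rfl fun j _ => ?_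
        rw [mul_pow]; ring
      rw [this]
      exact sum_mem fun j _ => Subalgebra.smul_mem _ (pow_mem (norm_sq_mem_polyFunctions d) j) _
    have hFm := fun N => ih (f * S N) (mul_mem hf (hSm N))
    choose hF hF' using hFm
    have hG : MemLp (fun x : EuclideanSpace ℝ (Fin d) => A * Real.exp (2 * ε * ‖x‖ ^ 2)) p
        (gaussianMeas d) :=
      memLp_of_le_exp hp (by fun_prop : Continuous _).aestronglyMeasurable hεp A
        fun x => by rw [abs_of_nonneg (by positivity)]
    have he1 : ∀ x : EuclideanSpace ℝ (Fin d), Real.exp (-ε * ‖x‖ ^ 2) ≤ 1 := fun x =>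
      Real.exp_le_one_iff.2 (by
        have : 0 ≤ ε * ‖x‖ ^ 2 := by positivity
        linarith)
    have hbd : ∀ (u : ℝ) (m : ℕ) (x : EuclideanSpace ℝ (Fin d)),
        |u| ≤ Real.exp (ε * ‖x‖ ^ 2) →
        |f x * u * Real.exp (-ε * ‖x‖ ^ 2) ^ m| ≤ A * Real.exp (2 * ε * ‖x‖ ^ 2) := by
      intro u m x hu
      rw [abs_mul, abs_mul, abs_pow, Real.abs_exp]
      calc |f x| * |u| * Real.exp (-ε * ‖x‖ ^ 2) ^ m
          ≤ (A * Real.exp (ε * ‖x‖ ^ 2)) * Real.exp (ε * ‖x‖ ^ 2) * 1 := by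
            gcongr
            · exact hfA x
            · exact pow_le_one₀ (Real.exp_pos _).le (he1 x)
        _ = _ := by
            rw [mul_one, mul_assoc, ← Real.exp_add]; ring_nf
    have hlimm : MemLp (f * fun x => Real.exp (-ε * ‖x‖ ^ 2) ^ (n + 1)) p (gaussianMeas d) := by
      refine hG.mono' (hfc.mul (by fun_prop)).aestronglyMeasurable
        (Filter.Eventually.of_forall fun x => ?_)
      have := hbd 1 (n + 1) x (by rw [abs_one]; exact Real.one_le_exp (by positivity))
      simpa using this
    refine ⟨hlimm, (Submodule.isClosed_topologicalClosure _).mem_of_tendsto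
      (tendsto_toLp_of_dominated hp hF hlimm hG (fun N x => ?_) fun x => ?_)
      (Filter.Eventually.of_forall hF')⟩
    · refine hbd _ n x ((abs_sum_exp_le _ N).trans (le_of_eq ?_))
      rw [neg_mul, abs_neg, abs_of_nonneg (by positivity)]
    · have h1 : Filter.Tendsto (fun N => S N x) Filter.atTop
          (nhds (Real.exp (-ε * ‖x‖ ^ 2))) := by
        rw [Real.exp_eq_exp_ℝ]
        exact (NormedSpace.expSeries_div_hasSum_exp (-ε * ‖x‖ ^ 2)).tendsto_sum_nat
      have h2 := (h1.const_mul (f x)).mul_const (Real.exp (-ε * ‖x‖ ^ 2) ^ n)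
      simpa [pow_succ, mul_assoc, mul_comm, mul_left_comm] using h2

theorem adjoin_gaussian_le_hermiteClosure (hp : p ≠ ∞) {ε : ℝ} (hε : 0 < ε)
    (hεp : 2 * ε * p.toReal < 1) {g : EuclideanSpace ℝ (Fin d) → ℝ}
    (hg : g ∈ Algebra.adjoin ℝ ((polyFunctions d : Set (EuclideanSpace ℝ (Fin d) → ℝ)) ∪
      {fun x => Real.exp (-ε * ‖x‖ ^ 2)})) : g ∈ hermiteClosure d p hp := by
  set M := Submodule.span ℝ {h : EuclideanSpace ℝ (Fin d) → ℝ | ∃ f ∈ polyFunctions d, ∃ n : ℕ,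
    h = f * fun x => Real.exp (-ε * ‖x‖ ^ 2) ^ n} with hM
  have hMle : M ≤ hermiteClosure d p hp := by
    rw [hM, Submodule.span_le]
    rintro _ ⟨f, hf, n, rfl⟩
    exact poly_mul_gaussian_mem_hermiteClosure hp hε hεp n f hf
  have key : ∀ h ∈ M, g * h ∈ M := by
    induction hg using Algebra.adjoin_induction with
    | mem g hg =>
      intro h hh
      induction hh using Submodule.span_induction with
      | mem h hh =>
        obtain ⟨f, hf, n, rfl⟩ := hh
        refine Submodule.subset_span ?_
        rcases hg with hg | hg
        · exact ⟨g * f, mul_mem hg hf, n, by rw [mul_assoc]⟩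
        · refine ⟨f, hf, n + 1, ?_⟩
          rw [Set.mem_singleton_iff] at hg
          subst hg
          ext x
          simp only [Pi.mul_apply, pow_succ]
          ring
      | zero => simp
      | add g h _ _ hg hh => rw [mul_add]; exact Submodule.add_mem _ hg hh
      | smul a g _ hg => rw [mul_smul_comm]; exact Submodule.smul_mem _ _ hg
    | algebraMap a =>
      intro h hh
      rw [← Algebra.smul_def]
      exact Submodule.smul_mem _ _ hh
    | add f₁ f₂ _ _ h₁ h₂ =>
      intro g hg
      rw [add_mul]
      exact Submodule.add_mem _ (h₁ g hg) (h₂ g hg)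
    | mul f₁ f₂ _ _ h₁ h₂ =>
      intro g hg
      rw [mul_assoc]
      exact h₁ _ (h₂ g hg)
  refine hMle ?_
  have := key 1 (Submodule.subset_span ⟨1, one_mem _, 0, by ext x; simp⟩)
  simpa using this

/-- Stone–Weierstrass on the one-point compactification. Polynomials do not extend to infinity, but
polynomials times the Gaussian extend by `0`, and they suffice to separate points. -/
theorem exists_adjoin_gaussian_near {ε : ℝ} (hε : 0 < ε) {f : EuclideanSpace ℝ (Fin d) → ℝ}
    (hf : Continuous f) (hfs : HasCompactSupport f) {δ : ℝ} (hδ : 0 < δ) :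
    ∃ g ∈ Algebra.adjoin ℝ ((polyFunctions d : Set (EuclideanSpace ℝ (Fin d) → ℝ)) ∪
      {fun x => Real.exp (-ε * ‖x‖ ^ 2)}), Continuous g ∧ ∀ x, |g x - f x| < δ := by
  set S := Algebra.adjoin ℝ ((polyFunctions d : Set (EuclideanSpace ℝ (Fin d) → ℝ)) ∪
      {fun x => Real.exp (-ε * ‖x‖ ^ 2)}) with hS
  let res : C(OnePoint (EuclideanSpace ℝ (Fin d)), ℝ) →ₐ[ℝ] (EuclideanSpace ℝ (Fin d) → ℝ) :=
    { toFun := fun F x => F (x : OnePoint (EuclideanSpace ℝ (Fin d)))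
      map_one' := rfl
      map_mul' := fun _ _ => rfl
      map_zero' := rfl
      map_add' := fun _ _ => rfl
      commutes' := fun _ => rfl }
  have hexp : Filter.Tendsto (fun x : EuclideanSpace ℝ (Fin d) => Real.exp (-(ε / 2) * ‖x‖ ^ 2))
      (Filter.coclosedCompact _) (nhds 0) := by
    rw [Filter.coclosedCompact_eq_cocompact]
    refine Real.tendsto_exp_atBot.comp ?_
    simp only [neg_mul]
    refine Filter.tendsto_neg_atTop_atBot.comp ?_
    exact Filter.Tendsto.const_mul_atTop (by positivity)
      ((Filter.tendsto_pow_atTop two_ne_zero).comp tendsto_norm_cocompact_atTop)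
  have hext : ∀ P ∈ polyFunctions d, ∃ F : C(OnePoint (EuclideanSpace ℝ (Fin d)), ℝ),
      (∀ x : EuclideanSpace ℝ (Fin d), F x = P x * Real.exp (-ε * ‖x‖ ^ 2)) ∧
      F OnePoint.infty = 0 ∧ F ∈ S.comap res := by
    intro P hP
    obtain ⟨hPc, hPg⟩ := polyFunctions_le_subgaussianGrowth d hP
    obtain ⟨A, hA, hPA⟩ := hPg (ε / 2) (by positivity)
    refine ⟨OnePoint.continuousMapMk ⟨fun x => P x * Real.exp (-ε * ‖x‖ ^ 2),
      hPc.mul (by fun_prop)⟩ 0 ?_, fun x => rfl, rfl, ?_⟩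
    · refine squeeze_zero_norm (a := fun x => A * Real.exp (-(ε / 2) * ‖x‖ ^ 2)) (fun x => ?_) ?_
      · simp only [ContinuousMap.coe_mk, norm_mul, Real.norm_eq_abs, Real.abs_exp]
        calc |P x| * Real.exp (-ε * ‖x‖ ^ 2)
            ≤ A * Real.exp (ε / 2 * ‖x‖ ^ 2) * Real.exp (-ε * ‖x‖ ^ 2) := by
              gcongr
              exact hPA x
          _ = _ := by rw [mul_assoc, ← Real.exp_add]; ring_nf
      · simpa using hexp.const_mul A
    · exact S.mul_mem (Algebra.subset_adjoin (Set.mem_union_left _ hP))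
        (Algebra.subset_adjoin (Set.mem_union_right _ rfl))
  -- The Gaussian is positive at finite points and zero at infinity. If it agrees at two distinct
  -- finite points, its product with a differing coordinate separates them.
  have hsep : (S.comap res).SeparatesPoints := by
    obtain ⟨F, hF, hF0, hFm⟩ := hext 1 (one_mem _)
    intro a b hab
    by_cases hFab : F a = F b
    swap
    · exact ⟨F, ⟨F, hFm, rfl⟩, hFab⟩
    have hpos : ∀ x : EuclideanSpace ℝ (Fin d), 0 < F x := by
      intro x
      rw [hF]
      simpa using Real.exp_pos _
    induction a using OnePoint.rec with
    | infty =>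
      induction b using OnePoint.rec with
      | infty => exact absurd rfl hab
      | coe b => rw [hF0] at hFab; exact absurd hFab (hpos b).ne
    | coe a =>
      induction b using OnePoint.rec with
      | infty => rw [hF0] at hFab; exact absurd hFab (hpos a).ne'
      | coe b =>
        have hab' : a ≠ b := fun h => hab (by rw [h])
        obtain ⟨i, hi⟩ : ∃ i, a i ≠ b i := by
          by_contra! h
          exact hab' (PiLp.ext h)
        obtain ⟨Q, hQ, _, hQm⟩ := hext _ (coord_mem_polyFunctions i)
        refine ⟨Q, ⟨Q, hQm, rfl⟩, ?_⟩
        rw [hQ, hQ]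
        rw [hF, hF] at hFab
        simp only [Pi.one_apply, one_mul] at hFab
        rw [hFab]
        exact fun h => hi (mul_right_cancel₀ (Real.exp_pos _).ne' h)
  let f' : C(OnePoint (EuclideanSpace ℝ (Fin d)), ℝ) :=
    OnePoint.continuousMapMk ⟨f, hf⟩ 0 (by
      rw [Filter.coclosedCompact_eq_cocompact]
      exact hfs.is_zero_at_infty)
  obtain ⟨⟨g, hg⟩, hgf⟩ := ContinuousMap.exists_mem_subalgebra_near_continuous_of_separatesPoints
    (S.comap res) hsep f' f'.continuous δ hδ
  exact ⟨res g, hg, g.continuous.comp OnePoint.continuous_coe, fun x => hgf x⟩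

/-- Hermite polynomials span a dense subspace of `L^p(γ)`. -/
theorem dense_span_hermiteLp (hp : p ≠ ∞) :
    Dense (Submodule.span ℝ (Set.range (hermiteLp (d := d) hp)) :
      Set (Lp ℝ p (gaussianMeas d))) := by
  have hp1 : 1 ≤ p := Fact.out
  have hp0 : 0 < p.toReal := ENNReal.toReal_pos (zero_lt_one.trans_le hp1).ne' hp
  set ε := 1 / (4 * p.toReal) with hε
  have hε0 : 0 < ε := by positivity
  have hεp : 2 * ε * p.toReal < 1 := by
    rw [hε]; field_simp; norm_num
  intro f
  rw [Metric.mem_closure_iff_infDist_zero ⟨0, Submodule.zero_mem _⟩]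
  refine le_antisymm (le_of_forall_pos_le_add fun δ hδ => ?_) Metric.infDist_nonneg
  obtain ⟨g, hgs, hgf, hgc, hgm⟩ := (Lp.memLp f).exists_hasCompactSupport_eLpNorm_sub_le hp
    (ε := ENNReal.ofReal (δ / 2)) (by positivity)
  obtain ⟨h, hh, hhc, hhg⟩ := exists_adjoin_gaussian_near hε0 hgc hgs (half_pos hδ)
  obtain ⟨hm, hcl⟩ := adjoin_gaussian_le_hermiteClosure hp hε0 hεp hh
  have d1 : dist f (hgm.toLp g) ≤ δ / 2 := by
    rw [dist_eq_norm, ← Lp.toLp_coeFn f (Lp.memLp f), ← MemLp.toLp_sub, Lp.norm_toLp]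
    exact ENNReal.toReal_le_of_le_ofReal (by positivity) hgf
  have d2 : dist (hgm.toLp g) (hm.toLp h) ≤ δ / 2 := by
    rw [dist_eq_norm, ← MemLp.toLp_sub]
    refine (Lp.norm_le_of_ae_bound (C := δ / 2) (by positivity) ?_).trans ?_
    · filter_upwards [(hgm.sub hm).coeFn_toLp] with x hx
      rw [hx, Pi.sub_apply, norm_sub_rev]
      exact (hhg x).le
    · simp [measureUnivNNReal]
  have h3 : Metric.infDist (hm.toLp h) (Submodule.span ℝ (Set.range (hermiteLp (d := d) hp)) :
      Set (Lp ℝ p (gaussianMeas d))) = 0 := by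
    rw [← Metric.mem_closure_iff_infDist_zero ⟨0, Submodule.zero_mem _⟩]
    exact hcl
  have h4 := Metric.infDist_le_infDist_add_dist (x := f) (y := hm.toLp h)
    (s := (Submodule.span ℝ (Set.range (hermiteLp (d := d) hp)) :
      Set (Lp ℝ p (gaussianMeas d))))
  have h5 := dist_triangle f (hgm.toLp g) (hm.toLp h)
  linarith

theorem clm_ext_hermiteLp (hp : p ≠ ∞) {F : Type*} [NormedAddCommGroup F] [NormedSpace ℝ F]
    {A B : Lp ℝ p (gaussianMeas d) →L[ℝ] F}
    (h : ∀ ν, A (hermiteLp hp ν) = B (hermiteLp hp ν)) : A = B := by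
  refine ContinuousLinearMap.ext_on (dense_span_hermiteLp hp) ?_
  rintro _ ⟨ν, rfl⟩
  exact h ν

/-- On the Hermite span the dependence on `r` is polynomial, including at `r = 1`, where the
operator is the identity. Contractivity makes approximation from the span uniform in `r`. -/
theorem continuousOn_mehlerOp (hp : p ≠ ∞) (f : Lp ℝ p (gaussianMeas d)) :
    ContinuousOn (fun r => mehlerOp d p r f) (Set.Icc 0 1) := by
  refine continuousOn_of_uniform_approx_of_continuousOn fun u hu => ?_
  obtain ⟨δ, hδ, hδu⟩ := Metric.mem_uniformity_dist.1 hu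
  obtain ⟨g, hg, hfg⟩ := Metric.dense_iff.1 (dense_span_hermiteLp (d := d) hp) f δ hδ
  refine ⟨fun r => mehlerOp d p r g, ?_, fun r _ => hδu ?_⟩
  · clear hg
    induction hfg using Submodule.span_induction with
    | mem g hg =>
      obtain ⟨ν, rfl⟩ := hg
      refine ContinuousOn.congr (f := fun r : ℝ => r ^ (∑ i, ν i) • hermiteLp hp ν) ?_
        fun r hr => mehlerOp_hermiteLp hp hr.1 hr.2 ν
      fun_prop
    | zero => simpa using continuousOn_const
    | add g h _ _ hg hh => simpa [Pi.add_def] using hg.add hh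
    | smul a g _ hg => simpa [Pi.smul_def] using hg.const_smul a
  · rw [dist_eq_norm, ← map_sub]
    refine (norm_mehlerOp_apply_le _ _).trans_lt ?_
    rw [← dist_eq_norm, dist_comm]
    exact hg

end Density

/-! ### Subordination kernels and their Laplace-type transforms. -/

theorem exists_abs_polynomial_mul_gaussian_le (P : Polynomial ℝ) :
    ∃ B : ℝ, 0 ≤ B ∧ ∀ y : ℝ, |P.eval y * Real.exp (-y ^ 2)| ≤ B * Real.exp (-y ^ 2 / 2) := by
  have h : ∃ B : ℝ, 0 ≤ B ∧ ∀ y : ℝ, |P.eval y| ≤ B * Real.exp (y ^ 2 / 2) := by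
    induction P using Polynomial.induction_on' with
    | add p q hp hq =>
      obtain ⟨A, hA, hp⟩ := hp
      obtain ⟨B, hB, hq⟩ := hq
      refine ⟨A + B, by positivity, fun y => ?_⟩
      rw [Polynomial.eval_add, add_mul]
      exact (abs_add_le _ _).trans (add_le_add (hp y) (hq y))
    | monomial n a =>
      refine ⟨|a| * (n.factorial * Real.exp (1 / 2)), by positivity, fun y => ?_⟩
      rw [Polynomial.eval_monomial, abs_mul, abs_pow, mul_assoc, mul_assoc]
      gcongr
      have h1 := Real.pow_div_factorial_le_exp |y| (abs_nonneg y) n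
      rw [div_le_iff₀ (by positivity)] at h1
      refine h1.trans ?_
      rw [← Real.exp_add, mul_comm]
      gcongr
      nlinarith [sq_nonneg (|y| - 1), sq_abs y]
  obtain ⟨B, hB, h⟩ := h
  refine ⟨B, hB, fun y => ?_⟩
  rw [abs_mul, Real.abs_exp]
  calc |P.eval y| * Real.exp (-y ^ 2) ≤ B * Real.exp (y ^ 2 / 2) * Real.exp (-y ^ 2) := by
        gcongr
        exact h y
    _ = _ := by rw [mul_assoc, ← Real.exp_add]; ring_nf

/-- The `k`-th derivative in `s` of the subordination density
`π^{-1/2} s v^{-1/2} e^{-s² v}`. -/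
noncomputable def subordKernel (k : ℕ) (s v : ℝ) : ℝ :=
  (-1) ^ k / (2 * Real.sqrt Real.pi) * v ^ ((k : ℝ) / 2 - 1) *
    ((physHermite (k + 1)).eval (s * Real.sqrt v) * Real.exp (-(s * Real.sqrt v) ^ 2))

theorem measurable_subordKernel (k : ℕ) :
    Measurable fun z : ℝ × ℝ => subordKernel k z.1 z.2 := by
  unfold subordKernel
  have := (physHermite (k + 1)).continuous.measurable
  fun_prop

theorem subordKernel_zero (s : ℝ) {v : ℝ} (hv : 0 < v) :
    subordKernel 0 s v = (Real.sqrt Real.pi)⁻¹ * (s / Real.sqrt v * Real.exp (-(s ^ 2 * v))) := by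
  have h : v ^ (((0 : ℕ) : ℝ) / 2 - 1) = (Real.sqrt v * Real.sqrt v)⁻¹ := by
    rw [Real.mul_self_sqrt hv.le]
    norm_num
    rw [Real.rpow_neg_one]
  have hs : 0 < Real.sqrt v := Real.sqrt_pos.2 hv
  rw [subordKernel, h, mul_pow, Real.sq_sqrt hv.le]
  simp only [physHermite]
  simp
  field_simp

theorem hasDerivAt_subordKernel (k : ℕ) (s : ℝ) {v : ℝ} (hv : 0 < v) :
    HasDerivAt (fun s => subordKernel k s v) (subordKernel (k + 1) s v) s := by
  have h1 : HasDerivAt (fun s : ℝ => s * Real.sqrt v) (Real.sqrt v) s := by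
    simpa using (hasDerivAt_id s).mul_const (Real.sqrt v)
  have h2 := (hasDerivAt_physHermite_mul_gaussian (k + 1) (s * Real.sqrt v)).comp s h1
  have h3 := h2.const_mul ((-1) ^ k / (2 * Real.sqrt Real.pi) * v ^ ((k : ℝ) / 2 - 1))
  refine h3.congr_deriv ?_
  have h : v ^ (((k + 1 : ℕ) : ℝ) / 2 - 1) = v ^ ((k : ℝ) / 2 - 1) * Real.sqrt v := by
    rw [Real.sqrt_eq_rpow, ← Real.rpow_add hv]
    push_cast
    ring_nf
  rw [subordKernel, h]
  ring

theorem exists_abs_subordKernel_le (k : ℕ) : ∃ C : ℝ, 0 ≤ C ∧ ∀ s v : ℝ, 0 < v →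
    |subordKernel k s v| ≤ C * (1 + |s|) *
      ((v ^ (-(1 / 2) : ℝ) + v ^ ((k : ℝ) - 1 / 2)) * Real.exp (-(s ^ 2 / 2) * v)) := by
  -- For `k = 0` the power `v^{k/2-1} = v⁻¹` is not integrable at `0`; the factor `s√v` from `H_1`
  -- restores `v^{-1/2}`. For `k ≥ 1` the power alone suffices.
  rcases k with _ | k
  · refine ⟨(Real.sqrt Real.pi)⁻¹, by positivity, fun s v hv => ?_⟩
    rw [subordKernel_zero s hv, abs_mul, abs_mul, abs_div, Real.abs_exp,
      abs_of_nonneg (Real.sqrt_nonneg v), abs_of_nonneg (by positivity : 0 ≤ (√Real.pi)⁻¹),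
      Real.rpow_neg hv.le, ← Real.sqrt_eq_rpow, mul_assoc]
    refine mul_le_mul_of_nonneg_left ?_ (by positivity)
    have h1 : Real.exp (-(s ^ 2 * v)) ≤ Real.exp (-(s ^ 2 / 2) * v) := by
      gcongr
      nlinarith [mul_nonneg (sq_nonneg s) hv.le]
    have h2 : 0 ≤ v ^ (((0 : ℕ) : ℝ) - 1 / 2) := by positivity
    rw [← mul_assoc]
    refine mul_le_mul ?_ h1 (Real.exp_pos _).le (by positivity)
    rw [div_eq_mul_inv]
    gcongr
    · linarith
    · linarith
  · obtain ⟨B, hB, hB'⟩ := exists_abs_polynomial_mul_gaussian_le (physHermite (k + 1 + 1))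
    refine ⟨(2 * Real.sqrt Real.pi)⁻¹ * B, by positivity, fun s v hv => ?_⟩
    have h0 := hB' (s * Real.sqrt v)
    have e1 : -(s * Real.sqrt v) ^ 2 / 2 = -(s ^ 2 / 2) * v := by
      rw [mul_pow, Real.sq_sqrt hv.le]; ring
    rw [e1] at h0
    have h1 : v ^ (((k + 1 : ℕ) : ℝ) / 2 - 1) ≤
        v ^ (-(1 / 2) : ℝ) + v ^ (((k + 1 : ℕ) : ℝ) - 1 / 2) := by
      have p1 : 0 ≤ v ^ (-(1 / 2) : ℝ) := by positivity
      have p2 : 0 ≤ v ^ (((k + 1 : ℕ) : ℝ) - 1 / 2) := by positivity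
      have hk : (0 : ℝ) ≤ k := Nat.cast_nonneg k
      rcases le_total v 1 with hv1 | hv1
      · have := Real.rpow_le_rpow_of_exponent_ge hv hv1
          (show (-(1 / 2) : ℝ) ≤ ((k + 1 : ℕ) : ℝ) / 2 - 1 by push_cast; linarith)
        linarith
      · have := Real.rpow_le_rpow_of_exponent_le hv1
          (show ((k + 1 : ℕ) : ℝ) / 2 - 1 ≤ ((k + 1 : ℕ) : ℝ) - 1 / 2 by push_cast; linarith)
        linarith
    rw [subordKernel, abs_mul, abs_mul, abs_div, abs_pow, abs_neg, abs_one, one_pow,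
      abs_of_nonneg (by positivity : 0 ≤ 2 * √Real.pi),
      abs_of_nonneg (by positivity : 0 ≤ v ^ (((k + 1 : ℕ) : ℝ) / 2 - 1))]
    calc 1 / (2 * √Real.pi) * v ^ (((k + 1 : ℕ) : ℝ) / 2 - 1) *
          |(physHermite (k + 1 + 1)).eval (s * √v) * Real.exp (-(s * √v) ^ 2)|
        ≤ 1 / (2 * √Real.pi) * (v ^ (-(1 / 2) : ℝ) + v ^ (((k + 1 : ℕ) : ℝ) - 1 / 2)) *
          (B * Real.exp (-(s ^ 2 / 2) * v)) := by gcongr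
      _ = (2 * √Real.pi)⁻¹ * B * 1 * ((v ^ (-(1 / 2) : ℝ) + v ^ (((k + 1 : ℕ) : ℝ) - 1 / 2)) *
          Real.exp (-(s ^ 2 / 2) * v)) := by ring
      _ ≤ _ := by
        gcongr
        linarith [abs_nonneg s]

theorem exists_one_add_pow_le_exp (N : ℕ) {b : ℝ} (hb : 0 < b) : ∃ C : ℝ, 0 ≤ C ∧
    ∀ v : ℝ, 0 ≤ v → (1 + v) ^ N ≤ C * Real.exp (b * v) := by
  refine ⟨N.factorial / b ^ N * Real.exp b, by positivity, fun v hv => ?_⟩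
  have h1 := Real.pow_div_factorial_le_exp (b * (1 + v)) (by positivity) N
  rw [div_le_iff₀ (by positivity), mul_pow] at h1
  rw [mul_assoc, ← Real.exp_add, div_mul_eq_mul_div, le_div_iff₀ (by positivity)]
  rw [show b + b * v = b * (1 + v) by ring]
  linarith

theorem integrableOn_rpow_add_rpow_mul_exp (k : ℕ) {b : ℝ} (hb : 0 < b) :
    IntegrableOn (fun v : ℝ => (v ^ (-(1 / 2) : ℝ) + v ^ ((k : ℝ) - 1 / 2)) * Real.exp (-b * v))
      (Set.Ioi 0) := by
  have hk : (0 : ℝ) ≤ k := Nat.cast_nonneg k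
  have h1 := integrableOn_rpow_mul_exp_neg_mul_rpow (p := 1) (s := -(1 / 2)) (b := b)
    (by norm_num) one_pos hb
  have h2 := integrableOn_rpow_mul_exp_neg_mul_rpow (p := 1) (s := (k : ℝ) - 1 / 2) (b := b)
    (by linarith) one_pos hb
  refine (h1.add h2).congr (Filter.Eventually.of_forall fun v => ?_)
  simp only [Pi.add_apply, Real.rpow_one]
  ring

/-- A majorant uniform in `s ∈ [s₀, s₁]`, for differentiating under the integral. Half of the decay
`e^{-s₀² v/2}` absorbs the factor `(1 + v)^N`, which later measures the growth of the Mehler kernel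
at time `1/(4v)`. -/
theorem exists_subordKernel_dominated (k N : ℕ) (A : ℝ) {s₀ : ℝ} (hs₀ : 0 < s₀) (s₁ : ℝ) :
    ∃ D : ℝ, ∀ s, s₀ ≤ s → s ≤ s₁ → ∀ v, 0 < v → ∀ F : ℝ, |F| ≤ A * (1 + v) ^ N →
      |subordKernel k s v * F| ≤ D * ((v ^ (-(1 / 2) : ℝ) + v ^ ((k : ℝ) - 1 / 2)) *
        Real.exp (-(s₀ ^ 2 / 4) * v)) := by
  obtain ⟨C, hC, h1⟩ := exists_abs_subordKernel_le k
  obtain ⟨C', hC', h2⟩ := exists_one_add_pow_le_exp N (b := s₀ ^ 2 / 4) (by positivity)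
  refine ⟨C * (1 + |s₁|) * (|A| * C'), fun s hs hs' v hv F hF => ?_⟩
  have hs0 : 0 ≤ s := hs₀.le.trans hs
  have e1 : |s| ≤ |s₁| := by
    rw [abs_of_nonneg hs0, abs_of_nonneg (hs0.trans hs')]; exact hs'
  have e2 : Real.exp (-(s ^ 2 / 2) * v) ≤ Real.exp (-(s₀ ^ 2 / 2) * v) := by gcongr
  have e3 : |F| ≤ |A| * (C' * Real.exp (s₀ ^ 2 / 4 * v)) := by
    refine hF.trans ?_
    calc A * (1 + v) ^ N ≤ |A| * (1 + v) ^ N := by gcongr; exact le_abs_self A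
      _ ≤ _ := by gcongr; exact h2 v hv.le
  rw [abs_mul]
  calc |subordKernel k s v| * |F| ≤ (C * (1 + |s₁|) *
      ((v ^ (-(1 / 2) : ℝ) + v ^ ((k : ℝ) - 1 / 2)) * Real.exp (-(s₀ ^ 2 / 2) * v))) *
      (|A| * (C' * Real.exp (s₀ ^ 2 / 4 * v))) := by
        gcongr
        refine (h1 s v hv).trans ?_
        gcongr
    _ = C * (1 + |s₁|) * (|A| * C') * ((v ^ (-(1 / 2) : ℝ) + v ^ ((k : ℝ) - 1 / 2)) *
        (Real.exp (-(s₀ ^ 2 / 2) * v) * Real.exp (s₀ ^ 2 / 4 * v))) := by ring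
    _ = _ := by rw [← Real.exp_add]; ring_nf

theorem integrableOn_subordKernel_mul (k N : ℕ) (A : ℝ) {s : ℝ} (hs : 0 < s) {F : ℝ → ℝ}
    (hFm : AEStronglyMeasurable F (volume.restrict (Set.Ioi 0)))
    (hF : ∀ v, 0 < v → |F v| ≤ A * (1 + v) ^ N) :
    IntegrableOn (fun v => subordKernel k s v * F v) (Set.Ioi 0) := by
  obtain ⟨D, hD⟩ := exists_subordKernel_dominated k N A hs s
  refine Integrable.mono' ((integrableOn_rpow_add_rpow_mul_exp k
    (b := s ^ 2 / 4) (by positivity)).const_mul D) (AEStronglyMeasurable.mul ?_ hFm) ?_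
  · exact ((measurable_subordKernel k).comp (measurable_prodMk_left (x := s))).aestronglyMeasurable
  · filter_upwards [ae_restrict_mem measurableSet_Ioi] with v hv
    exact hD s le_rfl le_rfl v hv _ (hF v hv)

theorem integrableOn_subordKernel (k : ℕ) {s : ℝ} (hs : 0 < s) :
    IntegrableOn (subordKernel k s) (Set.Ioi 0) := by
  have := integrableOn_subordKernel_mul k 0 1 hs (F := fun _ => 1)
    aestronglyMeasurable_const (fun v _ => by simp)
  simpa using this

theorem hasDerivAt_integral_subordKernel (k N : ℕ) (A : ℝ) {s : ℝ} (hs : 0 < s) {F : ℝ → ℝ}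
    (hFm : AEStronglyMeasurable F (volume.restrict (Set.Ioi 0)))
    (hF : ∀ v, 0 < v → |F v| ≤ A * (1 + v) ^ N) :
    HasDerivAt (fun s => ∫ v in Set.Ioi 0, subordKernel k s v * F v)
      (∫ v in Set.Ioi 0, subordKernel (k + 1) s v * F v) s := by
  obtain ⟨D, hD⟩ := exists_subordKernel_dominated (k + 1) N A (half_pos hs) (2 * s)
  have hm : ∀ j s, AEStronglyMeasurable (fun v => subordKernel j s v * F v)
      (volume.restrict (Set.Ioi 0)) := fun j s => AEStronglyMeasurable.mul
    ((measurable_subordKernel j).comp (measurable_prodMk_left (x := s))).aestronglyMeasurable hFm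
  refine (hasDerivAt_integral_of_dominated_loc_of_deriv_le (s := Set.Icc (s / 2) (2 * s))
    (F := fun s v => subordKernel k s v * F v) (F' := fun s v => subordKernel (k + 1) s v * F v)
    (Icc_mem_nhds (by linarith) (by linarith)) (Filter.Eventually.of_forall fun s => hm k s)
    (integrableOn_subordKernel_mul k N A hs hFm hF) (hm _ _) ?_
    ((integrableOn_rpow_add_rpow_mul_exp (k + 1) (b := (s / 2) ^ 2 / 4)
      (by positivity)).const_mul D) ?_).2
  · filter_upwards [ae_restrict_mem measurableSet_Ioi] with v hv x hx
    exact hD x hx.1 hx.2 v hv _ (hF v hv)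
  · filter_upwards [ae_restrict_mem measurableSet_Ioi] with v hv x hx
    exact (hasDerivAt_subordKernel k x hv).mul_const _

theorem iteratedDeriv_integral_subordKernel (N : ℕ) (A : ℝ) {F : ℝ → ℝ}
    (hFm : AEStronglyMeasurable F (volume.restrict (Set.Ioi 0)))
    (hF : ∀ v, 0 < v → |F v| ≤ A * (1 + v) ^ N) {u : ℝ → ℝ}
    (hu : ∀ s, 0 < s → u s = ∫ v in Set.Ioi 0, subordKernel 0 s v * F v) (k : ℕ) :
    ∀ s, 0 < s → iteratedDeriv k u s = ∫ v in Set.Ioi 0, subordKernel k s v * F v := by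
  induction k with
  | zero => simpa using hu
  | succ k ih =>
    intro s hs
    rw [iteratedDeriv_succ]
    have : iteratedDeriv k u =ᶠ[nhds s]
        fun s => ∫ v in Set.Ioi 0, subordKernel k s v * F v := by
      filter_upwards [Ioi_mem_nhds hs] with x hx
      exact ih x hx
    rw [this.deriv_eq]
    exact (hasDerivAt_integral_subordKernel k N A hs hFm hF).deriv

theorem subordKernel_scale (k : ℕ) {s v : ℝ} (hs : 0 < s) (hv : 0 < v) :
    subordKernel k s v = (s ^ k)⁻¹ * s ^ 2 * subordKernel k 1 (s ^ 2 * v) := by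
  have h1 : Real.sqrt (s ^ 2 * v) = s * Real.sqrt v := by
    rw [Real.sqrt_mul (by positivity), Real.sqrt_sq hs.le]
  have h2 : (s ^ 2 * v) ^ ((k : ℝ) / 2 - 1) = s ^ k * (s ^ 2)⁻¹ * v ^ ((k : ℝ) / 2 - 1) := by
    rw [Real.mul_rpow (by positivity) hv.le]
    congr 1
    rw [← Real.rpow_natCast s 2, ← Real.rpow_mul hs.le, ← Real.rpow_natCast s k,
      ← Real.rpow_neg hs.le, ← Real.rpow_add hs]
    congr 1
    push_cast
    ring
  rw [subordKernel, subordKernel, h1, h2, one_mul]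
  field_simp

/-- Scaling in `v` is the source of the bound `‖∂_s^k P_s‖ ≤ C s^{-k}`. -/
theorem integral_abs_subordKernel (k : ℕ) {s : ℝ} (hs : 0 < s) :
    ∫ v in Set.Ioi 0, |subordKernel k s v| =
      (∫ v in Set.Ioi 0, |subordKernel k 1 v|) * (s ^ k)⁻¹ := by
  have h := integral_comp_mul_left_Ioi (fun v => |subordKernel k 1 v|) 0
    (b := s ^ 2) (by positivity)
  rw [mul_zero, smul_eq_mul] at h
  have h2 : ∫ v in Set.Ioi 0, |subordKernel k s v| =
      ∫ v in Set.Ioi 0, (s ^ k)⁻¹ * s ^ 2 * |subordKernel k 1 (s ^ 2 * v)| := by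
    refine setIntegral_congr_fun measurableSet_Ioi fun v hv => ?_
    rw [subordKernel_scale k hs hv, abs_mul, abs_of_nonneg (by positivity)]
  rw [h2, integral_const_mul, h]
  field_simp

/-- An explicit antiderivative: with `Φ(z) = ∫_0^z e^{-y²} dy`, take `e^{-2sb} Φ(s√v - b/√v) +
e^{2sb} Φ(s√v + b/√v)`. The prefactors cancel the cross terms of the squares, and the derivatives of
the two arguments add up to `s/√v`. -/
theorem integral_exp_sub_div_sqrt {s b : ℝ} (hs : 0 < s) (hb : 0 ≤ b) :
    ∫ v in Set.Ioi (0 : ℝ), s / Real.sqrt v * Real.exp (-(s ^ 2 * v) - b ^ 2 / v) =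
      Real.sqrt Real.pi * Real.exp (-(2 * s * b)) := by
  set Φ : ℝ → ℝ := fun z => ∫ y in (0 : ℝ)..z, Real.exp (-y ^ 2) with hΦ
  have hΦd : ∀ z, HasDerivAt Φ (Real.exp (-z ^ 2)) z := fun z =>
    (by fun_prop : Continuous fun y : ℝ => Real.exp (-y ^ 2)).integral_hasStrictDerivAt 0 z
      |>.hasDerivAt
  have hgi : Integrable fun y : ℝ => Real.exp (-y ^ 2) := by
    simpa using integrable_exp_neg_mul_sq one_pos
  have hΦt : Filter.Tendsto Φ Filter.atTop (nhds (Real.sqrt Real.pi / 2)) := by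
    have h1 := intervalIntegral_tendsto_integral_Ioi (f := fun y : ℝ => Real.exp (-y ^ 2)) 0
      hgi.integrableOn Filter.tendsto_id
    have h2 := integral_gaussian_Ioi 1
    simp only [neg_mul, one_mul, div_one] at h2
    rwa [h2] at h1
  have hΦo : ∀ z, Φ (-z) = -Φ z := by
    intro z
    have := intervalIntegral.integral_comp_neg (f := fun y : ℝ => Real.exp (-y ^ 2))
      (a := 0) (b := z)
    simp only [neg_sq, neg_zero] at this
    simp only [hΦ]
    rw [this, intervalIntegral.integral_symm]
  have hΦb : Filter.Tendsto Φ Filter.atBot (nhds (-(Real.sqrt Real.pi / 2))) := by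
    have := (hΦt.comp Filter.tendsto_neg_atBot_atTop).neg
    refine this.congr fun z => ?_
    simp [hΦo]
  set L := (Real.exp (2 * s * b) - Real.exp (-(2 * s * b))) * (Real.sqrt Real.pi / 2) with hL
  set G : ℝ → ℝ := fun v => Real.exp (-(2 * s * b)) * Φ (s * Real.sqrt v - b / Real.sqrt v) +
    Real.exp (2 * s * b) * Φ (s * Real.sqrt v + b / Real.sqrt v) with hG
  have hsq0 : Filter.Tendsto Real.sqrt (nhdsWithin 0 (Set.Ioi 0)) (nhdsWithin 0 (Set.Ioi 0)) := by
    refine tendsto_nhdsWithin_iff.2 ⟨?_, ?_⟩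
    · have := Real.continuous_sqrt.tendsto 0
      rw [Real.sqrt_zero] at this
      exact this.mono_left nhdsWithin_le_nhds
    · filter_upwards [self_mem_nhdsWithin] with v hv
      exact Real.sqrt_pos.2 hv
  have hsqs : Filter.Tendsto (fun v => s * Real.sqrt v) (nhdsWithin 0 (Set.Ioi 0)) (nhds 0) := by
    simpa using (hsq0.mono_right nhdsWithin_le_nhds).const_mul s
  have hG0 : Filter.Tendsto G (nhdsWithin 0 (Set.Ioi 0)) (nhds L) := by
    rcases hb.eq_or_lt with rfl | hb
    · have hΦ0 := ((hΦd 0).continuousAt.tendsto).comp hsqs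
      have e0 : Φ 0 = 0 := by simp [hΦ]
      rw [e0] at hΦ0
      simpa [hG, hL, Function.comp_def] using hΦ0.add hΦ0
    · have hdiv : Filter.Tendsto (fun v => b / Real.sqrt v) (nhdsWithin 0 (Set.Ioi 0))
          Filter.atTop := by
        simp only [div_eq_mul_inv]
        exact (tendsto_inv_nhdsGT_zero.comp hsq0).const_mul_atTop hb
      have h1 : Filter.Tendsto (fun v => s * Real.sqrt v - b / Real.sqrt v)
          (nhdsWithin 0 (Set.Ioi 0)) Filter.atBot := by
        simp only [sub_eq_add_neg]
        exact hsqs.add_atBot (Filter.tendsto_neg_atTop_atBot.comp hdiv)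
      have h2 : Filter.Tendsto (fun v => s * Real.sqrt v + b / Real.sqrt v)
          (nhdsWithin 0 (Set.Ioi 0)) Filter.atTop := hsqs.add_atTop hdiv
      have h3 := ((hΦb.comp h1).const_mul (Real.exp (-(2 * s * b)))).add
        ((hΦt.comp h2).const_mul (Real.exp (2 * s * b)))
      have e : L = Real.exp (-(2 * s * b)) * -(Real.sqrt Real.pi / 2) +
          Real.exp (2 * s * b) * (Real.sqrt Real.pi / 2) := by rw [hL]; ring
      rw [e]
      exact h3
  have hsqt : Filter.Tendsto Real.sqrt Filter.atTop Filter.atTop := Real.tendsto_sqrt_atTop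
  have hGt : Filter.Tendsto G Filter.atTop
      (nhds ((Real.exp (-(2 * s * b)) + Real.exp (2 * s * b)) * (Real.sqrt Real.pi / 2))) := by
    have hdiv : Filter.Tendsto (fun v => b / Real.sqrt v) Filter.atTop (nhds 0) :=
      hsqt.const_div_atTop b
    have hs1 : Filter.Tendsto (fun v => s * Real.sqrt v) Filter.atTop Filter.atTop :=
      hsqt.const_mul_atTop hs
    have h1 : Filter.Tendsto (fun v => s * Real.sqrt v - b / Real.sqrt v) Filter.atTop
        Filter.atTop := by
      simp only [sub_eq_add_neg]
      exact hs1.atTop_add hdiv.neg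
    have h2 : Filter.Tendsto (fun v => s * Real.sqrt v + b / Real.sqrt v) Filter.atTop
        Filter.atTop := hs1.atTop_add hdiv
    have h3 := ((hΦt.comp h1).const_mul (Real.exp (-(2 * s * b)))).add
      ((hΦt.comp h2).const_mul (Real.exp (2 * s * b)))
    rw [add_mul]
    exact h3
  have hGd : ∀ v, 0 < v → HasDerivAt G
      (s / Real.sqrt v * Real.exp (-(s ^ 2 * v) - b ^ 2 / v)) v := by
    intro v hv
    have hq : 0 < Real.sqrt v := Real.sqrt_pos.2 hv
    have hq2 : Real.sqrt v ^ 2 = v := Real.sq_sqrt hv.le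
    have d0 := Real.hasDerivAt_sqrt hv.ne'
    have d1 := d0.const_mul s
    have d2 : HasDerivAt (fun v => b / Real.sqrt v)
        (-(b * (1 / (2 * Real.sqrt v))) / Real.sqrt v ^ 2) v := by
      refine ((hasDerivAt_const v b).div d0 hq.ne').congr_deriv ?_
      simp
    have e1 := ((hΦd _).comp v (d1.sub d2)).const_mul (Real.exp (-(2 * s * b)))
    have e2 := ((hΦd _).comp v (d1.add d2)).const_mul (Real.exp (2 * s * b))
    refine (e1.add e2).congr_deriv ?_
    have x1 : Real.exp (-(2 * s * b)) * Real.exp (-(s * Real.sqrt v - b / Real.sqrt v) ^ 2) =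
        Real.exp (-(s ^ 2 * v) - b ^ 2 / v) := by
      rw [← Real.exp_add, ← hq2]
      congr 1
      rw [Real.sqrt_sq hq.le]
      field_simp
      ring
    have x2 : Real.exp (2 * s * b) * Real.exp (-(s * Real.sqrt v + b / Real.sqrt v) ^ 2) =
        Real.exp (-(s ^ 2 * v) - b ^ 2 / v) := by
      rw [← Real.exp_add, ← hq2]
      congr 1
      rw [Real.sqrt_sq hq.le]
      field_simp
      ring
    simp only [Pi.sub_apply, Pi.add_apply]
    rw [← mul_assoc, ← mul_assoc, x1, x2]
    field_simp
    ring
  -- Since `b / 0 = 0`, the value of `G` at `0` is `0`, which is not its right limit `L` when `b >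
  -- 0`; hence the redefinition at that point.
  have hfin := integral_Ioi_of_hasDerivAt_of_nonneg (g := Function.update G 0 L)
    (g' := fun v => s / Real.sqrt v * Real.exp (-(s ^ 2 * v) - b ^ 2 / v)) (a := 0)
    (l := (Real.exp (-(2 * s * b)) + Real.exp (2 * s * b)) * (Real.sqrt Real.pi / 2)) ?_ ?_ ?_ ?_
  · rw [hfin, Function.update_self, hL]
    ring
  · rw [continuousWithinAt_update_same]
    simpa [Set.Ici_sdiff_left] using hG0
  · intro v hv
    refine (hGd v hv).congr_of_eventuallyEq ?_
    filter_upwards [Ioi_mem_nhds (Set.mem_Ioi.1 hv)] with x hx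
    rw [Function.update_of_ne (ne_of_gt hx)]
  · intro v _
    positivity
  · refine hGt.congr' ?_
    filter_upwards [Filter.eventually_gt_atTop 0] with x hx
    rw [Function.update_of_ne (ne_of_gt hx)]

/-- The Laplace-type transforms of the subordination densities. -/
theorem integral_subordKernel_mul_exp (k : ℕ) {s : ℝ} (hs : 0 < s) {m : ℝ} (hm : 0 ≤ m) :
    ∫ v in Set.Ioi 0, subordKernel k s v * Real.exp (-(m / (4 * v))) =
      (-Real.sqrt m) ^ k * Real.exp (-(s * Real.sqrt m)) := by
  have h := iteratedDeriv_integral_subordKernel 0 1 (F := fun v => Real.exp (-(m / (4 * v))))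
    (by fun_prop : Measurable _).aestronglyMeasurable (fun v hv => by
      rw [Real.abs_exp, pow_zero, one_mul, Real.exp_le_one_iff, neg_nonpos]
      positivity) (u := fun s => Real.exp (-Real.sqrt m * s)) (fun s hs => ?_) k s hs
  · rw [← h, iteratedDeriv_exp_const_mul]
    ring_nf
  · have h1 := integral_exp_sub_div_sqrt hs (b := Real.sqrt m / 2) (by positivity)
    have h2 : ∫ v in Set.Ioi 0, subordKernel 0 s v * Real.exp (-(m / (4 * v))) =
        ∫ v in Set.Ioi 0, (Real.sqrt Real.pi)⁻¹ * (s / Real.sqrt v *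
          Real.exp (-(s ^ 2 * v) - (Real.sqrt m / 2) ^ 2 / v)) := by
      refine setIntegral_congr_fun measurableSet_Ioi fun v hv => ?_
      rw [subordKernel_zero s hv, mul_assoc, mul_assoc, ← Real.exp_add, div_pow,
        Real.sq_sqrt hm]
      congr 4
      have : v ≠ 0 := ne_of_gt hv
      field_simp
      ring
    rw [h2, integral_const_mul, h1, inv_mul_cancel_left₀ (Real.sqrt_pos.2 Real.pi_pos).ne']
    ring_nf

/-! ### The Poisson–Hermite derivatives as operators on `L^p`. -/

theorem exists_clm_integral {α : Type*} [MeasurableSpace α] {μ : Measure α} {E F : Type*}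
    [NormedAddCommGroup E] [NormedSpace ℝ E] [NormedAddCommGroup F] [NormedSpace ℝ F]
    {A : α → E →L[ℝ] F} {b : α → ℝ} (hb : Integrable b μ)
    (hA : ∀ f, AEStronglyMeasurable (fun a => A a f) μ)
    (h : ∀ᵐ a ∂μ, ∀ f, ‖A a f‖ ≤ b a * ‖f‖) :
    ∃ S : E →L[ℝ] F, (∀ f, S f = ∫ a, A a f ∂μ) ∧ ∀ f, ‖S f‖ ≤ (∫ a, b a ∂μ) * ‖f‖ := by
  have hint : ∀ f, Integrable (fun a => A a f) μ := fun f =>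
    Integrable.mono' (hb.mul_const ‖f‖) (hA f) (h.mono fun a ha => ha f)
  have hbd : ∀ f, ‖∫ a, A a f ∂μ‖ ≤ (∫ a, b a ∂μ) * ‖f‖ := by
    intro f
    rw [← integral_mul_const]
    exact norm_integral_le_of_norm_le (hb.mul_const ‖f‖) (h.mono fun a ha => ha f)
  refine ⟨LinearMap.mkContinuous
    { toFun := fun f => ∫ a, A a f ∂μ
      map_add' := fun f g => ?_
      map_smul' := fun c f => ?_ } _ hbd, fun f => rfl, hbd⟩
  · simp only [map_add]
    exact integral_add (hint f) (hint g)
  · simp only [map_smul, RingHom.id_apply]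
    exact integral_smul c _

section Operators

variable {d : ℕ} {p : ℝ≥0∞} [Fact (1 ≤ p)]

/-- The absolute value keeps the parameter in `(0, 1]` at all real times, so continuity, and then
measurability in `v`, holds on the whole line. -/
theorem continuous_mehlerOp_exp_neg_abs (hp : p ≠ ∞) (f : Lp ℝ p (gaussianMeas d)) :
    Continuous fun τ : ℝ => mehlerOp d p (Real.exp (-|τ|)) f :=
  (continuousOn_mehlerOp hp f).comp_continuous (by fun_prop) fun τ =>
    ⟨(Real.exp_pos _).le, Real.exp_le_one_iff.2 (by simp)⟩

variable (d p) in
/-- The Ornstein-Uhlenbeck operator at time `1 / (4v)`. -/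
noncomputable def ouInvTime (v : ℝ) : Lp ℝ p (gaussianMeas d) →L[ℝ] Lp ℝ p (gaussianMeas d) :=
  mehlerOp d p (Real.exp (-|1 / (4 * v)|))

theorem stronglyMeasurable_ouInvTime (hp : p ≠ ∞) (f : Lp ℝ p (gaussianMeas d)) :
    StronglyMeasurable fun v => ouInvTime d p v f :=
  (continuous_mehlerOp_exp_neg_abs hp f).stronglyMeasurable.comp_measurable
    (by fun_prop : Measurable fun v : ℝ => 1 / (4 * v))

theorem ouInvTime_hermiteLp (hp : p ≠ ∞) {v : ℝ} (hv : 0 < v) (ν : Fin d → ℕ) :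
    ouInvTime d p v (hermiteLp hp ν) =
      Real.exp (-(((∑ i, ν i : ℕ) : ℝ) / (4 * v))) • hermiteLp hp ν := by
  rw [ouInvTime, mehlerOp_hermiteLp hp (Real.exp_pos _).le (Real.exp_le_one_iff.2 (by simp)),
    abs_of_pos (by positivity), ← Real.exp_nat_mul]
  congr 2
  ring

theorem stronglyMeasurable_subordKernel_smul (hp : p ≠ ∞) (k : ℕ)
    (f : Lp ℝ p (gaussianMeas d)) :
    StronglyMeasurable fun z : ℝ × ℝ => subordKernel k z.1 z.2 • ouInvTime d p z.2 f :=
  (measurable_subordKernel k).stronglyMeasurable.smul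
    ((stronglyMeasurable_ouInvTime hp f).comp_measurable measurable_snd)

theorem exists_poissonOp (hp : p ≠ ∞) (k : ℕ) {s : ℝ} (hs : 0 < s) :
    ∃ V : Lp ℝ p (gaussianMeas d) →L[ℝ] Lp ℝ p (gaussianMeas d),
      (∀ f, V f = ∫ v in Set.Ioi 0, subordKernel k s v • ouInvTime d p v f) ∧
      ∀ f, ‖V f‖ ≤ (∫ v in Set.Ioi 0, |subordKernel k s v|) * ‖f‖ := by
  refine exists_clm_integral (A := fun v => subordKernel k s v • ouInvTime d p v)
    (integrableOn_subordKernel k hs).abs (fun f => ?_) (Filter.Eventually.of_forall fun v f => ?_)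
  · exact ((stronglyMeasurable_subordKernel_smul hp k f).comp_measurable
      (measurable_prodMk_left (x := s))).aestronglyMeasurable
  · rw [smul_apply, norm_smul, Real.norm_eq_abs]
    gcongr
    exact norm_mehlerOp_apply_le _ _

variable (d p) in
open Classical in
/-- The operator `∂_s^k P_s` on `L^p(γ)`, `s > 0`, for the Poisson-Hermite semigroup `P_s`. -/
noncomputable def poissonOp (k : ℕ) (s : ℝ) :
    Lp ℝ p (gaussianMeas d) →L[ℝ] Lp ℝ p (gaussianMeas d) :=
  if h : p ≠ ∞ ∧ 0 < s then (exists_poissonOp h.1 k h.2).choose else 0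

theorem poissonOp_apply (hp : p ≠ ∞) (k : ℕ) {s : ℝ} (hs : 0 < s)
    (f : Lp ℝ p (gaussianMeas d)) :
    poissonOp d p k s f = ∫ v in Set.Ioi 0, subordKernel k s v • ouInvTime d p v f := by
  have h : p ≠ ∞ ∧ 0 < s := ⟨hp, hs⟩
  rw [poissonOp, dif_pos h]
  exact (exists_poissonOp h.1 k h.2).choose_spec.1 f

theorem norm_poissonOp_le (k : ℕ) {s : ℝ} (hs : 0 < s) (f : Lp ℝ p (gaussianMeas d)) :
    ‖poissonOp d p k s f‖ ≤ (∫ v in Set.Ioi 0, |subordKernel k 1 v|) * (s ^ k)⁻¹ * ‖f‖ := by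
  rw [poissonOp]
  split_ifs with h
  · rw [← integral_abs_subordKernel k hs]
    exact (exists_poissonOp h.1 k h.2).choose_spec.2 f
  · have : 0 ≤ ∫ v in Set.Ioi 0, |subordKernel k 1 v| :=
      integral_nonneg fun v => abs_nonneg _
    rw [zero_apply, norm_zero]
    positivity

theorem stronglyMeasurable_poissonOp (hp : p ≠ ∞) (k : ℕ) (f : Lp ℝ p (gaussianMeas d)) :
    StronglyMeasurable fun s => poissonOp d p k s f := by
  have h1 : StronglyMeasurable fun s =>
      ∫ v in Set.Ioi 0, subordKernel k s v • ouInvTime d p v f :=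
    (stronglyMeasurable_subordKernel_smul hp k f).integral_prod_right'
      (ν := volume.restrict (Set.Ioi 0))
  have h2 := h1.indicator (measurableSet_Ioi (a := (0 : ℝ)))
  convert h2 using 1
  ext1 s
  by_cases hs : 0 < s
  · rw [Set.indicator_of_mem (Set.mem_Ioi.2 hs), poissonOp_apply hp k hs]
  · rw [Set.indicator_of_notMem (by simpa using hs), poissonOp, dif_neg (fun h => hs h.2),
      zero_apply]

theorem poissonOp_hermiteLp (hp : p ≠ ∞) (k : ℕ) {s : ℝ} (hs : 0 < s) (ν : Fin d → ℕ) :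
    poissonOp d p k s (hermiteLp hp ν) =
      ((-Real.sqrt (∑ i, ν i : ℕ)) ^ k * Real.exp (-(s * Real.sqrt (∑ i, ν i : ℕ)))) •
        hermiteLp hp ν := by
  rw [poissonOp_apply hp k hs, ← integral_subordKernel_mul_exp k hs (Nat.cast_nonneg _),
    ← integral_smul_const]
  refine setIntegral_congr_fun measurableSet_Ioi fun v hv => ?_
  rw [ouInvTime_hermiteLp hp hv, smul_smul]

/-- The semigroup law at equal times: on each `h_ν` powers and exponentials multiply. It lets `j`
derivatives be traded for a factor of order `r^{-j}` while `k` stay on `f`. -/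
theorem poissonOp_add (hp : p ≠ ∞) (j k : ℕ) {r : ℝ} (hr : 0 < r)
    (f : Lp ℝ p (gaussianMeas d)) :
    poissonOp d p (j + k) r f = poissonOp d p j (r / 2) (poissonOp d p k (r / 2) f) := by
  have : poissonOp d p (j + k) r = (poissonOp d p j (r / 2)).comp (poissonOp d p k (r / 2)) := by
    refine clm_ext_hermiteLp hp fun ν => ?_
    rw [ContinuousLinearMap.comp_apply, poissonOp_hermiteLp hp k (half_pos hr), map_smul,
      poissonOp_hermiteLp hp j (half_pos hr), poissonOp_hermiteLp hp _ hr, smul_smul]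
    congr 1
    rw [pow_add, mul_mul_mul_comm, ← Real.exp_add]
    ring_nf
  rw [this, ContinuousLinearMap.comp_apply]

/-- Approximate `f` by `u_n` in the Hermite span. `Ψ x (u_n)` converges for every `x` by continuity,
while `S u_n` converges almost everywhere along a subsequence, so the limits agree. -/
theorem ae_eval_eq_of_hermiteLp (hp : p ≠ ∞)
    {Ψ : EuclideanSpace ℝ (Fin d) → Lp ℝ p (gaussianMeas d) →L[ℝ] ℝ}
    {S : Lp ℝ p (gaussianMeas d) →L[ℝ] Lp ℝ p (gaussianMeas d)}
    (h : ∀ ν, ∀ᵐ x ∂(gaussianMeas d), Ψ x (hermiteLp hp ν) = S (hermiteLp hp ν) x)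
    (f : Lp ℝ p (gaussianMeas d)) : ∀ᵐ x ∂(gaussianMeas d), Ψ x f = S f x := by
  have hspan : ∀ g ∈ Submodule.span ℝ (Set.range (hermiteLp (d := d) hp)),
      ∀ᵐ x ∂(gaussianMeas d), Ψ x g = S g x := by
    intro g hg
    induction hg using Submodule.span_induction with
    | mem g hg => obtain ⟨ν, rfl⟩ := hg; exact h ν
    | zero =>
      filter_upwards [Lp.coeFn_zero ℝ p (gaussianMeas d)] with x hx
      rw [map_zero, map_zero, hx, Pi.zero_apply]
    | add g₁ g₂ _ _ h₁ h₂ =>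
      filter_upwards [h₁, h₂, Lp.coeFn_add (S g₁) (S g₂)] with x e1 e2 e3
      rw [map_add, map_add, e3, Pi.add_apply, e1, e2]
    | smul a g _ hg =>
      filter_upwards [hg, Lp.coeFn_smul a (S g)] with x e1 e2
      rw [map_smul, map_smul, e2, Pi.smul_apply, e1]
  obtain ⟨u, hu, hlim⟩ := mem_closure_iff_seq_limit.1 (dense_span_hermiteLp (d := d) hp f)
  have h1 : Filter.Tendsto (fun n => S (u n)) Filter.atTop (nhds (S f)) :=
    (S.continuous.tendsto f).comp hlim
  obtain ⟨φ, hφ, hφlim⟩ := (tendstoInMeasure_of_tendsto_Lp h1).exists_seq_tendsto_ae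
  have hall : ∀ᵐ x ∂(gaussianMeas d), ∀ n, Ψ x (u n) = S (u n) x :=
    ae_all_iff.2 fun n => hspan _ (hu n)
  filter_upwards [hall, hφlim] with x e1 e2
  have h3 : Filter.Tendsto (fun n => Ψ x (u (φ n))) Filter.atTop (nhds (Ψ x f)) :=
    ((Ψ x).continuous.tendsto f).comp (hlim.comp hφ.tendsto_atTop)
  simp only [e1] at h3
  exact tendsto_nhds_unique h3 e2

/-- The substitution `u = s² v` moves all dependence on `s` into the kernel and leaves `T_{1/(4v)}`,
so derivatives in `s` never fall on the semigroup. -/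
theorem poissonHermite_eq_integral {s : ℝ} (hs : 0 < s) (f : EuclideanSpace ℝ (Fin d) → ℝ)
    (x : EuclideanSpace ℝ (Fin d)) :
    poissonHermite s f x =
      ∫ v in Set.Ioi 0, subordKernel 0 s v * ouSemigroup (1 / (4 * v)) f x := by
  have h := integral_comp_mul_left_Ioi (fun u => Real.exp (-u) / Real.sqrt u *
    ouSemigroup (s ^ 2 / (4 * u)) f x) 0 (b := s ^ 2) (by positivity)
  rw [mul_zero, smul_eq_mul, ← div_eq_inv_mul, eq_div_iff (by positivity)] at h
  rw [poissonHermite, ← h, mul_comm, mul_assoc, ← integral_mul_const]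
  refine setIntegral_congr_fun measurableSet_Ioi fun v hv => ?_
  have hv0 : 0 < v := hv
  have h1 : s ^ 2 / (4 * (s ^ 2 * v)) = 1 / (4 * v) := by field_simp
  have h2 : Real.sqrt (s ^ 2 * v) = s * Real.sqrt v := by
    rw [Real.sqrt_mul (by positivity), Real.sqrt_sq hs.le]
  have hq : 0 < Real.sqrt v := Real.sqrt_pos.2 hv0
  simp only [subordKernel_zero s hv0, h1, h2]
  field_simp

/-- At time `1/(4v)` the normalising constant blows up only polynomially as `v → ∞`, because `1 -
e^{-1/(2v)} ≥ 1/(1 + 2v)`. -/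
theorem inv_sqrt_one_sub_exp_pow_le (d : ℕ) {v : ℝ} (hv : 0 < v) :
    (Real.sqrt (1 - Real.exp (-(1 / (4 * v))) ^ 2) ^ d)⁻¹ ≤ 2 ^ d * (1 + v) ^ d := by
  rw [← Real.exp_nat_mul, ← inv_pow, ← mul_pow]
  have h1 : 1 / (1 + 2 * v) ≤ 1 - Real.exp ((2 : ℕ) * -(1 / (4 * v))) := by
    have h2 := Real.add_one_le_exp (1 / (2 * v))
    have h3 : Real.exp ((2 : ℕ) * -(1 / (4 * v))) = (Real.exp (1 / (2 * v)))⁻¹ := by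
      rw [← Real.exp_neg]
      congr 1
      push_cast
      field_simp
      ring
    have h4 : (Real.exp (1 / (2 * v)))⁻¹ ≤ (1 / (2 * v) + 1)⁻¹ := by gcongr
    have h5 : 1 / (1 + 2 * v) = 1 - (1 / (2 * v) + 1)⁻¹ := by field_simp; ring
    rw [h3, h5]
    linarith
  gcongr
  rw [inv_le_comm₀ (Real.sqrt_pos.2 (lt_of_lt_of_le (by positivity) h1)) (by positivity)]
  refine Real.le_sqrt_of_sq_le (le_trans ?_ h1)
  rw [← one_div, div_pow, one_pow]
  gcongr
  nlinarith

/-- For each fixed `x` one differentiates under the scalar integral, obtaining a continuous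
functional of `f`. It agrees with the operator on Hermite polynomials, hence almost everywhere for
every `f`; the `L^p`-valued integral is never evaluated pointwise. -/
theorem iteratedDeriv_poissonHermite_ae (hp : p ≠ ∞) (k : ℕ) {s : ℝ} (hs : 0 < s)
    (f : Lp ℝ p (gaussianMeas d)) :
    (fun x => iteratedDeriv k (fun s : ℝ => poissonHermite s f x) s) =ᵐ[gaussianMeas d]
      poissonOp d p k s f := by
  have hr : ∀ v : ℝ, 0 < v → Real.exp (-(1 / (4 * v))) ^ 2 < 1 := by
    intro v hv
    rw [← Real.exp_nat_mul, Real.exp_lt_one_iff]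
    have : 0 < 1 / (4 * v) := by positivity
    push_cast
    linarith
  have hev : ∀ (v : ℝ) (x : EuclideanSpace ℝ (Fin d)),
      ∃ Φ : Lp ℝ p (gaussianMeas d) →L[ℝ] ℝ, 0 < v →
      (∀ f : Lp ℝ p (gaussianMeas d), Φ f = ouSemigroup (1 / (4 * v)) f x) ∧
      ∀ f, ‖Φ f‖ ≤ 2 ^ d * (1 + v) ^ d * Real.exp (‖x‖ ^ 2) * ‖f‖ := by
    intro v x
    by_cases hv : 0 < v
    · obtain ⟨Φ, h1, h2⟩ := exists_mehlerEval (p := p) (hr v hv) x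
      refine ⟨Φ, fun _ => ⟨fun f => ?_, fun f => (h2 f).trans ?_⟩⟩
      · rw [h1, ouSemigroup_eq (by positivity)]
      · gcongr
        exact inv_sqrt_one_sub_exp_pow_le d hv
    · exact ⟨0, fun h => absurd h hv⟩
  choose Φ hΦ using hev
  have hΦm : ∀ (x : EuclideanSpace ℝ (Fin d)) (g : Lp ℝ p (gaussianMeas d)),
      AEStronglyMeasurable (fun v => Φ v x g) (volume.restrict (Set.Ioi 0)) := by
    intro x g
    have hm := (measurable_integral_mehler (Lp.stronglyMeasurable g)).comp
      (by fun_prop : Measurable fun v : ℝ => (Real.exp (-(1 / (4 * v))), x))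
    refine hm.aestronglyMeasurable.congr ?_
    filter_upwards [ae_restrict_mem measurableSet_Ioi] with v hv
    have hv0 : 0 < v := hv
    rw [(hΦ v x hv).1, ouSemigroup_eq (by positivity)]
    rfl
  have hΨ : ∀ x, ∃ Ψ : Lp ℝ p (gaussianMeas d) →L[ℝ] ℝ,
      ∀ g, Ψ g = ∫ v in Set.Ioi 0, subordKernel k s v * Φ v x g := by
    intro x
    obtain ⟨Ψ, h1, _⟩ := exists_clm_integral (μ := volume.restrict (Set.Ioi (0 : ℝ)))
      (A := fun v => subordKernel k s v • Φ v x)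
      (integrableOn_subordKernel_mul k d (2 ^ d * Real.exp (‖x‖ ^ 2)) hs
        (F := fun v => 2 ^ d * (1 + v) ^ d * Real.exp (‖x‖ ^ 2))
        (by fun_prop : Continuous _).aestronglyMeasurable fun v hv => by
          rw [abs_of_nonneg (by positivity)]
          exact le_of_eq (by ring)).abs
      (fun g => AEStronglyMeasurable.smul ((measurable_subordKernel k).comp
        (measurable_prodMk_left (x := s))).aestronglyMeasurable (hΦm x g)) (by
        filter_upwards [ae_restrict_mem measurableSet_Ioi] with v hv g
        have hv0 : 0 < v := hv
        rw [smul_apply, norm_smul, Real.norm_eq_abs, abs_mul, mul_assoc]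
        gcongr
        rw [abs_of_nonneg (by positivity)]
        exact (hΦ v x hv).2 g)
    exact ⟨Ψ, fun g => by simpa using h1 g⟩
  choose Ψ hΨ using hΨ
  have hfin := ae_eval_eq_of_hermiteLp hp (Ψ := Ψ) (S := poissonOp d p k s) (fun ν => by
    rw [poissonOp_hermiteLp hp k hs]
    filter_upwards [(memLp_hermiteFun hp ν).coeFn_toLp, Lp.coeFn_smul
      ((-Real.sqrt (∑ i, ν i : ℕ)) ^ k * Real.exp (-(s * Real.sqrt (∑ i, ν i : ℕ))))
      (hermiteLp hp ν)] with x e1 e2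
    rw [e2, Pi.smul_apply, hermiteLp, e1, hΨ, smul_eq_mul,
      ← integral_subordKernel_mul_exp k hs (Nat.cast_nonneg _), ← integral_mul_const]
    refine setIntegral_congr_fun measurableSet_Ioi fun v hv => ?_
    have hv0 : 0 < v := hv
    simp only
    rw [(hΦ v x hv).1, ouSemigroup_eq (by positivity), mul_assoc]
    congr 1
    have e3 : Real.exp (-(((∑ i, ν i : ℕ) : ℝ) / (4 * v))) =
        Real.exp (-(1 / (4 * v))) ^ (∑ i, ν i) := by
      rw [← Real.exp_nat_mul]; congr 1; ring
    rw [e3, ← integral_mehler_hermiteFun (hr v hv)]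
    refine integral_congr_ae ?_
    filter_upwards [(memLp_hermiteFun hp ν).coeFn_toLp] with y hy
    rw [hy]) f
  filter_upwards [hfin] with x hx
  rw [← hx, hΨ]
  refine iteratedDeriv_integral_subordKernel d (2 ^ d * Real.exp (‖x‖ ^ 2) * ‖f‖)
    (F := fun v => Φ v x f) (hΦm x f) (fun v hv => ?_) (fun s hs => ?_) k s hs
  · refine ((hΦ v x hv).2 f).trans (le_of_eq ?_)
    ring
  · rw [poissonHermite_eq_integral hs]
    refine setIntegral_congr_fun measurableSet_Ioi fun v hv => ?_
    rw [(hΦ v x hv).1]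

theorem poissonDerivNorm_eq_enorm (hp : p ≠ ∞) (k : ℕ) {s : ℝ} (hs : 0 < s)
    (f : Lp ℝ p (gaussianMeas d)) :
    poissonDerivNorm p k f s = ‖poissonOp d p k s f‖ₑ := by
  rw [poissonDerivNorm, eLpNorm_congr_ae (iteratedDeriv_poissonHermite_ae hp k hs f), Lp.enorm_def]

/-! ### Existence and uniqueness of the Riesz potential. -/

/-- The Gamma integral for `|ν|^{-β/2}`. Subtracting the mean, which is `mehlerOp` at `0`, gives the
integrand the decay `e^{-τ}`; near `0` the power `τ^{β/2-1}` is integrable. -/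
theorem exists_isRieszPotential (hp1 : 1 < p) (hp : p ≠ ∞) {β : ℝ} (hβ : 0 < β) :
    ∃ I : Lp ℝ p (gaussianMeas d) →L[ℝ] Lp ℝ p (gaussianMeas d), IsRieszPotential β I := by
  obtain ⟨C, hC, hdecay⟩ := exists_norm_mehlerOp_sub_le (d := d) hp1 hp
  have hβ2 : 0 < β / 2 := by positivity
  have hcont : ∀ f : Lp ℝ p (gaussianMeas d), AEStronglyMeasurable
      (fun τ : ℝ => mehlerOp d p (Real.exp (-τ)) f) (volume.restrict (Set.Ioi 0)) := by
    intro f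
    refine (continuous_mehlerOp_exp_neg_abs hp f).aestronglyMeasurable.congr ?_
    filter_upwards [ae_restrict_mem measurableSet_Ioi] with τ hτ
    rw [abs_of_pos hτ]
  obtain ⟨I, hI, _⟩ := exists_clm_integral (μ := volume.restrict (Set.Ioi (0 : ℝ)))
    (A := fun τ : ℝ => τ ^ (β / 2 - 1) • (mehlerOp d p (Real.exp (-τ)) - mehlerOp d p 0))
    (b := fun τ => C * (Real.exp (-τ) * τ ^ (β / 2 - 1)))
    ((Real.GammaIntegral_convergent hβ2).const_mul C)
    (fun f => AEStronglyMeasurable.smul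
      (by fun_prop : Measurable fun τ : ℝ => τ ^ (β / 2 - 1)).aestronglyMeasurable
      ((hcont f).sub aestronglyMeasurable_const)) (by
    filter_upwards [ae_restrict_mem measurableSet_Ioi] with τ hτ f
    have hτ0 : 0 < τ := hτ
    have := hdecay (Real.exp (-τ)) (Real.exp_pos _).le
      (Real.exp_le_one_iff.2 (by linarith)) f
    rw [smul_apply, norm_smul, sub_apply,
      Real.norm_of_nonneg (by positivity)]
    calc _ ≤ τ ^ (β / 2 - 1) * (C * Real.exp (-τ) * ‖f‖) := by gcongr
      _ = _ := by ring)
  refine ⟨(Real.Gamma (β / 2))⁻¹ • I, fun ν => ⟨memLp_hermiteFun hp ν, ?_⟩⟩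
  change ((Real.Gamma (β / 2))⁻¹ • I) (hermiteLp hp ν) = _ • hermiteLp hp ν
  have hE : ∀ τ ∈ Set.Ioi (0 : ℝ), (τ ^ (β / 2 - 1) • (mehlerOp d p (Real.exp (-τ)) -
      mehlerOp d p 0)) (hermiteLp hp ν) =
      (τ ^ (β / 2 - 1) * (Real.exp (-τ) ^ (∑ i, ν i) - 0 ^ (∑ i, ν i))) • hermiteLp hp ν := by
    intro τ hτ
    have hτ0 : 0 < τ := hτ
    rw [smul_apply, sub_apply,
      mehlerOp_hermiteLp hp (Real.exp_pos _).le (Real.exp_le_one_iff.2 (by linarith)),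
      mehlerOp_hermiteLp hp le_rfl zero_le_one, ← sub_smul, smul_smul]
  rw [smul_apply, hI, setIntegral_congr_fun measurableSet_Ioi hE,
    integral_smul_const, smul_smul]
  congr 1
  -- For `ν = 0` the convention `0 ^ 0 = 1` makes the integrand vanish; for `ν ≠ 0` the subtracted
  -- term is zero.
  split_ifs with h0
  · simp [h0]
  · have hn : ∑ i, ν i ≠ 0 := by
      intro h
      refine h0 (funext fun i => ?_)
      exact (Finset.sum_eq_zero_iff.1 h) i (Finset.mem_univ i)
    have hn' : 0 < ((∑ i, ν i : ℕ) : ℝ) := by exact_mod_cast Nat.pos_of_ne_zero hn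
    have h1 := Real.integral_rpow_mul_exp_neg_mul_Ioi hβ2 hn'
    simp only [zero_pow hn, sub_zero, ← Real.exp_nat_mul, mul_neg]
    rw [h1, one_div, Real.inv_rpow hn'.le, ← Real.rpow_neg hn'.le]
    have := (Real.Gamma_pos_of_pos hβ2).ne'
    field_simp

theorem IsRieszPotential.apply_hermiteLp {β : ℝ}
    {I : Lp ℝ p (gaussianMeas d) →L[ℝ] Lp ℝ p (gaussianMeas d)} (hI : IsRieszPotential β I)
    (hp : p ≠ ∞) (ν : Fin d → ℕ) : I (hermiteLp hp ν) =
      (if ν = 0 then 0 else ((∑ i, ν i : ℕ) : ℝ) ^ (-(β / 2))) • hermiteLp hp ν := by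
  obtain ⟨_, h⟩ := hI ν
  exact h

theorem existsUnique_isRieszPotential (hp1 : 1 < p) (hp : p ≠ ∞) {β : ℝ} (hβ : 0 < β) :
    ∃! I : Lp ℝ p (gaussianMeas d) →L[ℝ] Lp ℝ p (gaussianMeas d), IsRieszPotential β I := by
  obtain ⟨I, hI⟩ := exists_isRieszPotential (d := d) hp1 hp hβ
  refine ⟨I, hI, fun J hJ => clm_ext_hermiteLp hp fun ν => ?_⟩
  rw [hI.apply_hermiteLp hp, hJ.apply_hermiteLp hp]

end Operators

/-! ### Dilation averages in `L^q(dt/t)`. -/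

theorem integrableOn_rpow_mul_one_add_rpow {β a : ℝ} (hβ : 0 < β) (ha : β < a) :
    IntegrableOn (fun σ : ℝ => σ ^ (β - 1) * (1 + σ) ^ (-a)) (Set.Ioi 0) := by
  have hm : Measurable fun σ : ℝ => σ ^ (β - 1) * (1 + σ) ^ (-a) := by fun_prop
  rw [← Set.Ioc_union_Ioi_eq_Ioi (zero_le_one (α := ℝ)), integrableOn_union]
  constructor
  · have h1 : IntegrableOn (fun σ : ℝ => σ ^ (β - 1)) (Set.Ioc 0 1) := by
      have := intervalIntegral.intervalIntegrable_rpow' (a := 0) (b := 1) (r := β - 1)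
        (by linarith)
      rwa [intervalIntegrable_iff_integrableOn_Ioc_of_le zero_le_one] at this
    refine Integrable.mono' h1 hm.aestronglyMeasurable ?_
    filter_upwards [ae_restrict_mem measurableSet_Ioc] with σ hσ
    have h0 : 0 < σ := hσ.1
    rw [Real.norm_of_nonneg (by positivity)]
    exact mul_le_of_le_one_right (by positivity)
      (Real.rpow_le_one_of_one_le_of_nonpos (by linarith) (by linarith))
  · have h1 := integrableOn_Ioi_rpow_of_lt (a := β - 1 - a) (by linarith) (zero_lt_one (α := ℝ))
    refine Integrable.mono' h1 hm.aestronglyMeasurable ?_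
    filter_upwards [ae_restrict_mem measurableSet_Ioi] with σ hσ
    have h0 : 0 < σ := zero_lt_one.trans hσ
    rw [Real.norm_of_nonneg (by positivity), sub_eq_add_neg (β - 1), Real.rpow_add h0]
    gcongr ?_ * ?_
    exact Real.rpow_le_rpow_of_nonpos h0 (by linarith) (by linarith)

theorem lintegral_Ioi_comp_mul_div {φ : ℝ → ℝ≥0∞} (hφ : Measurable φ) {c : ℝ} (hc : 0 < c) :
    ∫⁻ t in Set.Ioi (0 : ℝ), φ (c * t) * ENNReal.ofReal t⁻¹ =
      ∫⁻ t in Set.Ioi (0 : ℝ), φ t * ENNReal.ofReal t⁻¹ := by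
  have hF : Measurable ((Set.Ioi (0 : ℝ)).indicator fun t => φ t * ENNReal.ofReal t⁻¹) :=
    Measurable.indicator (hφ.mul (by fun_prop)) measurableSet_Ioi
  rw [← lintegral_indicator measurableSet_Ioi, ← lintegral_indicator measurableSet_Ioi]
  conv_rhs => rw [← Real.smul_map_volume_mul_left hc.ne']
  rw [lintegral_smul_measure, lintegral_map hF (measurable_const_mul c), smul_eq_mul,
    ← lintegral_const_mul' _ _ ENNReal.ofReal_ne_top]
  refine lintegral_congr fun t => ?_
  by_cases ht : 0 < t
  · rw [Set.indicator_of_mem (Set.mem_Ioi.2 ht), Set.indicator_of_mem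
      (Set.mem_Ioi.2 (mul_pos hc ht)), abs_of_pos hc, mul_left_comm, ← ENNReal.ofReal_mul hc.le,
      mul_inv, mul_inv_cancel_left₀ hc.ne']
  · rw [Set.indicator_of_notMem (by simpa using ht), Set.indicator_of_notMem, mul_zero]
    rw [Set.mem_Ioi, not_lt]
    exact mul_nonpos_of_nonneg_of_nonpos hc.le (not_lt.1 ht)

/-- A Hardy-type inequality in `L^q(dt/t)` for averages over dilations. -/
theorem lintegral_dilation_average_rpow_le {w G : ℝ → ℝ≥0∞} {c : ℝ → ℝ} (hw : Measurable w)
    (hG : Measurable G) (hc : Measurable c) (hc0 : ∀ σ, 0 < σ → 0 < c σ) {q : ℝ} (hq : 1 ≤ q)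
    {H : ℝ → ℝ≥0∞}
    (hH : ∀ t, 0 < t → H t ≤ ∫⁻ σ in Set.Ioi (0 : ℝ), w σ * G (c σ * t)) :
    ∫⁻ t in Set.Ioi (0 : ℝ), H t ^ q * ENNReal.ofReal t⁻¹ ≤
      (∫⁻ σ in Set.Ioi (0 : ℝ), w σ) ^ q *
        ∫⁻ t in Set.Ioi (0 : ℝ), G t ^ q * ENNReal.ofReal t⁻¹ := by
  set W := ∫⁻ σ in Set.Ioi (0 : ℝ), w σ with hW
  have hm : Measurable fun z : ℝ × ℝ => w z.2 * G (c z.2 * z.1) ^ q :=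
    (hw.comp measurable_snd).mul ((hG.comp
      ((hc.comp measurable_snd).mul measurable_fst)).pow_const q)
  -- Jensen in `σ` for each `t`, then Tonelli; invariance of `dt/t` removes the dilation by `c σ`,
  -- and the leftover mass completes `W^{q-1}` to `W^q`.
  calc ∫⁻ t in Set.Ioi (0 : ℝ), H t ^ q * ENNReal.ofReal t⁻¹
      ≤ ∫⁻ t in Set.Ioi (0 : ℝ), (W ^ (q - 1) *
          ∫⁻ σ in Set.Ioi (0 : ℝ), w σ * G (c σ * t) ^ q) * ENNReal.ofReal t⁻¹ := by
        refine setLIntegral_mono' measurableSet_Ioi fun t ht => ?_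
        gcongr
        calc H t ^ q ≤ (∫⁻ σ in Set.Ioi (0 : ℝ), w σ * G (c σ * t)) ^ q := by
              gcongr
              exact hH t ht
          _ ≤ _ := lintegral_mul_rpow_le hw.aemeasurable
              (hG.comp (hc.mul_const t)).aemeasurable hq
    _ = W ^ (q - 1) * ∫⁻ t in Set.Ioi (0 : ℝ), ∫⁻ σ in Set.Ioi (0 : ℝ),
          w σ * G (c σ * t) ^ q * ENNReal.ofReal t⁻¹ := by
        rw [← lintegral_const_mul]
        · refine lintegral_congr fun t => ?_
          rw [mul_assoc, lintegral_mul_const]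
          exact hm.comp measurable_prodMk_left
        · exact Measurable.lintegral_prod_right'
            (hm.mul (measurable_fst.inv.ennreal_ofReal))
    _ = W ^ (q - 1) * ∫⁻ σ in Set.Ioi (0 : ℝ), ∫⁻ t in Set.Ioi (0 : ℝ),
          w σ * G (c σ * t) ^ q * ENNReal.ofReal t⁻¹ := by
        congr 1
        exact lintegral_lintegral_swap
          (hm.mul (measurable_fst.inv.ennreal_ofReal)).aemeasurable
    _ = W ^ (q - 1) * ∫⁻ σ in Set.Ioi (0 : ℝ),
          w σ * ∫⁻ t in Set.Ioi (0 : ℝ), G t ^ q * ENNReal.ofReal t⁻¹ := by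
        congr 1
        refine setLIntegral_congr_fun measurableSet_Ioi fun σ hσ => ?_
        rw [← lintegral_Ioi_comp_mul_div (hG.pow_const q) (hc0 σ hσ), ← lintegral_const_mul]
        · simp only [mul_assoc]
        · exact ((hG.pow_const q).comp (measurable_const_mul _)).mul
            measurable_inv.ennreal_ofReal
    _ = W ^ q * ∫⁻ t in Set.Ioi (0 : ℝ), G t ^ q * ENNReal.ofReal t⁻¹ := by
        rw [lintegral_mul_const _ hw, ← hW, ← mul_assoc]
        congr 1
        conv_lhs => rw [← ENNReal.rpow_one W, ← ENNReal.rpow_mul, one_mul]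
        rw [← ENNReal.rpow_add_of_nonneg _ _ (by linarith) zero_le_one, sub_add_cancel]

/-! ### The Besov estimate for the Riesz potential. -/

section Riesz

variable {d : ℕ} {p : ℝ≥0∞} [Fact (1 ≤ p)]

/-- With `λ = √|ν|` this is `λ^{-β} = Γ(β)⁻¹ ∫_0^∞ s^{β-1} e^{-sλ} ds` multiplied by `e^{-tλ}`,
after `s = tσ`. The norm bound of order `(t(1+σ))^{-n}` and `n > β` give convergence at infinity. -/
theorem poissonOp_rieszPotential (hp : p ≠ ∞) {β : ℝ} (hβ : 0 < β)
    {I : Lp ℝ p (gaussianMeas d) →L[ℝ] Lp ℝ p (gaussianMeas d)} (hI : IsRieszPotential β I)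
    {n : ℕ} (hn : β < n) {t : ℝ} (ht : 0 < t) (f : Lp ℝ p (gaussianMeas d)) :
    poissonOp d p n t (I f) = ((Real.Gamma β)⁻¹ * t ^ β) •
      ∫ σ in Set.Ioi (0 : ℝ), σ ^ (β - 1) • poissonOp d p n (t * (1 + σ)) f := by
  -- At least one derivative is needed: it annihilates `h_0` on the right-hand side, matching `I h_0
  -- = 0`.
  have hn0 : n ≠ 0 := by
    rintro rfl
    simp only [Nat.cast_zero] at hn
    linarith
  set M := ∫ v in Set.Ioi 0, |subordKernel n 1 v| with hM
  obtain ⟨J, hJ, _⟩ := exists_clm_integral (μ := volume.restrict (Set.Ioi (0 : ℝ)))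
    (A := fun σ : ℝ => σ ^ (β - 1) • poissonOp d p n (t * (1 + σ)))
    (b := fun σ => M * (t ^ n)⁻¹ * (σ ^ (β - 1) * (1 + σ) ^ (-(n : ℝ))))
    ((integrableOn_rpow_mul_one_add_rpow hβ hn).const_mul _)
    (fun f => AEStronglyMeasurable.smul
      (by fun_prop : Measurable fun σ : ℝ => σ ^ (β - 1)).aestronglyMeasurable
      ((stronglyMeasurable_poissonOp hp n f).comp_measurable
        (by fun_prop : Measurable fun σ : ℝ => t * (1 + σ))).aestronglyMeasurable) (by
    filter_upwards [ae_restrict_mem measurableSet_Ioi] with σ hσ f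
    have hσ0 : 0 < σ := hσ
    rw [smul_apply, norm_smul, Real.norm_of_nonneg (by positivity)]
    calc _ ≤ σ ^ (β - 1) * (M * ((t * (1 + σ)) ^ n)⁻¹ * ‖f‖) := by
          gcongr
          exact norm_poissonOp_le n (by positivity) f
      _ = _ := by
          rw [mul_pow, mul_inv, Real.rpow_neg (by positivity), Real.rpow_natCast]
          ring)
  have key : (poissonOp d p n t).comp I = ((Real.Gamma β)⁻¹ * t ^ β) • J := by
    refine clm_ext_hermiteLp hp fun ν => ?_
    rw [ContinuousLinearMap.comp_apply, hI.apply_hermiteLp hp, map_smul,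
      poissonOp_hermiteLp hp n ht, smul_apply, hJ]
    have hE : ∀ σ ∈ Set.Ioi (0 : ℝ),
        (σ ^ (β - 1) • poissonOp d p n (t * (1 + σ))) (hermiteLp hp ν) =
        ((-Real.sqrt (∑ i, ν i : ℕ)) ^ n * Real.exp (-(t * Real.sqrt (∑ i, ν i : ℕ))) *
          (σ ^ (β - 1) * Real.exp (-(t * Real.sqrt (∑ i, ν i : ℕ) * σ)))) • hermiteLp hp ν := by
      intro σ hσ
      have hσ0 : 0 < σ := hσ
      rw [smul_apply, poissonOp_hermiteLp hp n (by positivity), smul_smul]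
      congr 1
      rw [show -(t * (1 + σ) * Real.sqrt (∑ i, ν i : ℕ)) = -(t * Real.sqrt (∑ i, ν i : ℕ)) +
        -(t * Real.sqrt (∑ i, ν i : ℕ) * σ) by ring, Real.exp_add]
      ring
    rw [setIntegral_congr_fun measurableSet_Ioi hE, integral_smul_const, smul_smul, smul_smul]
    congr 1
    by_cases h0 : ν = 0
    · simp [h0, hn0]
    · rw [if_neg h0]
      have hs : ∑ i, ν i ≠ 0 := by
        intro h
        refine h0 (funext fun i => ?_)
        exact (Finset.sum_eq_zero_iff.1 h) i (Finset.mem_univ i)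
      have hs' : 0 < ((∑ i, ν i : ℕ) : ℝ) := by exact_mod_cast Nat.pos_of_ne_zero hs
      have hq : 0 < Real.sqrt (∑ i, ν i : ℕ) := Real.sqrt_pos.2 hs'
      have h1 := Real.integral_rpow_mul_exp_neg_mul_Ioi hβ (mul_pos ht hq)
      have h2 : ((∑ i, ν i : ℕ) : ℝ) ^ (-(β / 2)) = (Real.sqrt (∑ i, ν i : ℕ) ^ β)⁻¹ := by
        rw [Real.sqrt_eq_rpow, ← Real.rpow_mul hs'.le, Real.rpow_neg hs'.le]
        ring_nf
      rw [integral_const_mul, h1, one_div, Real.inv_rpow (by positivity),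
        Real.mul_rpow ht.le hq.le, h2]
      have := (Real.Gamma_pos_of_pos hβ).ne'
      field_simp
  have := congrArg (fun S => S f) key
  simpa [hJ] using this

/-- Weighted norms of the derivatives of the Poisson-Hermite semigroup of a Riesz potential are
averages over dilations of those of the function. -/
theorem poissonOp_rieszPotential_le (hp : p ≠ ∞) {α β : ℝ} (hα : 0 ≤ α) (hβ : 0 < β)
    {I : Lp ℝ p (gaussianMeas d) →L[ℝ] Lp ℝ p (gaussianMeas d)} (hI : IsRieszPotential β I)
    {j k : ℕ} (hn : α + β < (j + k : ℕ)) :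
    ∃ A : ℝ, 0 ≤ A ∧ ∀ (f : Lp ℝ p (gaussianMeas d)) (t : ℝ), 0 < t →
      ENNReal.ofReal (t ^ (((j + k : ℕ) : ℝ) - (α + β))) * ‖poissonOp d p (j + k) t (I f)‖ₑ ≤
      ∫⁻ σ in Set.Ioi (0 : ℝ),
        ENNReal.ofReal (A * (σ ^ (β - 1) * (1 + σ) ^ (-(((j + k : ℕ) : ℝ) - α)))) *
        (ENNReal.ofReal (((1 + σ) / 2 * t) ^ ((k : ℝ) - α)) *
          ‖poissonOp d p k ((1 + σ) / 2 * t) f‖ₑ) := by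
  set M := ∫ v in Set.Ioi 0, |subordKernel j 1 v| with hM
  have hM0 : 0 ≤ M := integral_nonneg fun v => abs_nonneg _
  have hΓ := Real.Gamma_pos_of_pos hβ
  -- The power of `2` comes from halving the time: `2^j` from the norm bound and `2^{k-α}` from
  -- rewriting the weight at `(1+σ)t/2`.
  refine ⟨(Real.Gamma β)⁻¹ * M * 2 ^ (((j + k : ℕ) : ℝ) - α), by positivity, fun f t ht => ?_⟩
  rw [poissonOp_rieszPotential hp hβ hI (by linarith) ht, enorm_smul,
    Real.enorm_of_nonneg (by positivity), ← mul_assoc, ← ENNReal.ofReal_mul (by positivity)]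
  refine (mul_le_mul_right (enorm_integral_le_lintegral_enorm _) _).trans ?_
  rw [← lintegral_const_mul' _ _ ENNReal.ofReal_ne_top]
  refine setLIntegral_mono' measurableSet_Ioi fun σ hσ => ?_
  have hσ0 : 0 < σ := hσ
  have hu : 0 < t * (1 + σ) := by positivity
  have e0 : t * (1 + σ) / 2 = (1 + σ) / 2 * t := by ring
  have hbd := norm_poissonOp_le j (half_pos hu) (poissonOp d p k (t * (1 + σ) / 2) f)
  rw [← poissonOp_add hp j k hu, e0, ← hM] at hbd
  simp only [← ofReal_norm]
  rw [norm_smul, Real.norm_of_nonneg (by positivity), ← ENNReal.ofReal_mul (by positivity),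
    ← ENNReal.ofReal_mul (by positivity), ← ENNReal.ofReal_mul (by positivity)]
  refine ENNReal.ofReal_le_ofReal ?_
  calc t ^ (((j + k : ℕ) : ℝ) - (α + β)) * ((Real.Gamma β)⁻¹ * t ^ β) *
        (σ ^ (β - 1) * ‖poissonOp d p (j + k) (t * (1 + σ)) f‖)
      ≤ t ^ (((j + k : ℕ) : ℝ) - (α + β)) * ((Real.Gamma β)⁻¹ * t ^ β) *
        (σ ^ (β - 1) * (M * (((1 + σ) / 2 * t) ^ j)⁻¹ *
          ‖poissonOp d p k ((1 + σ) / 2 * t) f‖)) := by gcongr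
    _ = _ := by
      have hs : 0 < 1 + σ := by positivity
      have e1 : t ^ (((j + k : ℕ) : ℝ) - (α + β)) * t ^ β = t ^ j * t ^ ((k : ℝ) - α) := by
        rw [← Real.rpow_natCast t j, ← Real.rpow_add ht, ← Real.rpow_add ht]
        push_cast
        ring_nf
      have e2 : ((1 + σ) / 2 * t) ^ ((k : ℝ) - α) =
          (1 + σ) ^ ((k : ℝ) - α) * (2 ^ ((k : ℝ) - α))⁻¹ * t ^ ((k : ℝ) - α) := by
        rw [Real.mul_rpow (by positivity) ht.le, Real.div_rpow hs.le zero_le_two, div_eq_mul_inv]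
      have e3 : (1 + σ) ^ (-(((j + k : ℕ) : ℝ) - α)) =
          ((1 + σ) ^ j)⁻¹ * ((1 + σ) ^ ((k : ℝ) - α))⁻¹ := by
        rw [← Real.rpow_natCast (1 + σ) j, ← mul_inv, ← Real.rpow_add hs, Real.rpow_neg hs.le]
        push_cast
        ring_nf
      have e4 : (2 : ℝ) ^ (((j + k : ℕ) : ℝ) - α) = 2 ^ j * 2 ^ ((k : ℝ) - α) := by
        rw [← Real.rpow_natCast 2 j, ← Real.rpow_add two_pos]
        push_cast
        ring_nf
      rw [e2, e3, e4, mul_pow, div_pow]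
      have p1 : (0 : ℝ) < 2 ^ ((k : ℝ) - α) := by positivity
      have p2 : 0 < (1 + σ) ^ ((k : ℝ) - α) := by positivity
      calc _ = (t ^ (((j + k : ℕ) : ℝ) - (α + β)) * t ^ β) * ((Real.Gamma β)⁻¹ *
            (σ ^ (β - 1) * (M * ((1 + σ) ^ j / 2 ^ j * t ^ j)⁻¹ *
              ‖poissonOp d p k ((1 + σ) / 2 * t) f‖))) := by ring
        _ = _ := by
          rw [e1]
          field_simp

theorem besovSeminorm_eq (hp : p ≠ ∞) (α : ℝ) (q : ℝ≥0∞) (f : Lp ℝ p (gaussianMeas d)) :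
    besovSeminorm α p q f =
      if q = ∞ then
        ⨆ t ∈ Set.Ioi (0 : ℝ), ENNReal.ofReal (t ^ (((⌊α⌋₊ + 1 : ℕ) : ℝ) - α)) *
          ‖poissonOp d p (⌊α⌋₊ + 1) t f‖ₑ
      else
        (∫⁻ t in Set.Ioi (0 : ℝ), (ENNReal.ofReal (t ^ (((⌊α⌋₊ + 1 : ℕ) : ℝ) - α)) *
          ‖poissonOp d p (⌊α⌋₊ + 1) t f‖ₑ) ^ q.toReal * ENNReal.ofReal t⁻¹) ^ (1 / q.toReal) := by
  rw [besovSeminorm]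
  congr 1
  · refine iSup_congr fun t => iSup_congr fun ht => ?_
    rw [poissonDerivNorm_eq_enorm hp _ ht]
  · congr 1
    refine setLIntegral_congr_fun measurableSet_Ioi fun t ht => ?_
    rw [poissonDerivNorm_eq_enorm hp _ ht]

theorem exists_besovSeminorm_rieszPotential_le (hp : p ≠ ∞) {q : ℝ≥0∞} (hq : 1 ≤ q) {α β : ℝ}
    (hα : 0 ≤ α) (hβ : 0 < β)
    {I : Lp ℝ p (gaussianMeas d) →L[ℝ] Lp ℝ p (gaussianMeas d)} (hI : IsRieszPotential β I) :
    ∃ W : ℝ≥0∞, W ≠ ∞ ∧ ∀ f : Lp ℝ p (gaussianMeas d),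
      besovSeminorm (α + β) p q (I f) ≤ W * besovSeminorm α p q f := by
  obtain ⟨j, hj⟩ : ∃ j, ⌊α + β⌋₊ + 1 = j + (⌊α⌋₊ + 1) := by
    have : ⌊α⌋₊ ≤ ⌊α + β⌋₊ := Nat.floor_mono (by linarith)
    exact ⟨⌊α + β⌋₊ - ⌊α⌋₊, by omega⟩
  have hn : α + β < ((j + (⌊α⌋₊ + 1) : ℕ) : ℝ) := by
    rw [← hj]
    push_cast
    exact Nat.lt_floor_add_one _
  obtain ⟨A, hA, hle⟩ := poissonOp_rieszPotential_le hp hα hβ hI hn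
  set w : ℝ → ℝ := fun σ =>
    A * (σ ^ (β - 1) * (1 + σ) ^ (-(((j + (⌊α⌋₊ + 1) : ℕ) : ℝ) - α))) with hw
  have hwi : IntegrableOn w (Set.Ioi 0) :=
    -- The requirement here is `β < n - α`, which is the choice `n > α + β`.
    (integrableOn_rpow_mul_one_add_rpow hβ (by linarith)).const_mul A
  have hwm : Measurable w := by fun_prop
  set W := ∫⁻ σ in Set.Ioi (0 : ℝ), ENNReal.ofReal (w σ) with hW
  have hWt : W ≠ ∞ := by
    refine ((lintegral_mono fun σ => ?_).trans_lt hwi.2).ne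
    exact Real.ofReal_le_enorm _
  refine ⟨W, hWt, fun f => ?_⟩
  rw [besovSeminorm_eq hp, besovSeminorm_eq hp, hj]
  set G : ℝ → ℝ≥0∞ := fun t => ENNReal.ofReal (t ^ (((⌊α⌋₊ + 1 : ℕ) : ℝ) - α)) *
          ‖poissonOp d p (⌊α⌋₊ + 1) t f‖ₑ with hG
  have hGm : Measurable G :=
    (by fun_prop : Measurable fun t : ℝ => ENNReal.ofReal (t ^ (((⌊α⌋₊ + 1 : ℕ) : ℝ) - α))).mul
      (stronglyMeasurable_poissonOp hp _ f).enorm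
  split_ifs with hqt
  -- For `q = ∞` the average of `G` is at most the total weight times the supremum of `G`.
  · refine iSup₂_le fun t ht => (hle f t ht).trans ?_
    rw [← lintegral_mul_const _ hwm.ennreal_ofReal]
    refine setLIntegral_mono' measurableSet_Ioi fun σ hσ => ?_
    have hσ0 : 0 < σ := hσ
    have ht0 : 0 < t := ht
    gcongr
    exact le_iSup₂ (f := fun t (_ : t ∈ Set.Ioi (0 : ℝ)) => G t) ((1 + σ) / 2 * t)
      (Set.mem_Ioi.2 (by positivity))
  · have hq1 : 1 ≤ q.toReal := by
      rw [← ENNReal.toReal_one]; exact ENNReal.toReal_mono hqt hq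
    have hq0 : 0 < q.toReal := by linarith
    have := lintegral_dilation_average_rpow_le (w := fun σ => ENNReal.ofReal (w σ)) (G := G)
      (c := fun σ => (1 + σ) / 2) hwm.ennreal_ofReal hGm (by fun_prop)
      (fun σ hσ => by positivity) hq1 (fun t ht => hle f t ht)
    refine (ENNReal.rpow_le_rpow this (by positivity)).trans (le_of_eq ?_)
    rw [ENNReal.mul_rpow_of_nonneg _ _ (by positivity), ← ENNReal.rpow_mul,
      mul_one_div_cancel hq0.ne', ENNReal.rpow_one]

end Riesz

theorem mainTheorem1 (d : ℕ) (α β : ℝ) (hα : 0 ≤ α) (hβ : 0 < β)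
    (p q : ℝ≥0∞) [Fact (1 ≤ p)] (hp : 1 < p) (hp' : p < ∞) (hq : 1 ≤ q) :
    (∃! I : Lp ℝ p (gaussianMeas d) →L[ℝ] Lp ℝ p (gaussianMeas d), IsRieszPotential β I) ∧
    ∀ I : Lp ℝ p (gaussianMeas d) →L[ℝ] Lp ℝ p (gaussianMeas d), IsRieszPotential β I →
      ∃ C : ℝ≥0, ∀ f ∈ besovSpace d α p q,
        I f ∈ besovSpace d (α + β) p q ∧
        besovNorm (α + β) p q (I f) ≤ C * besovNorm α p q f := by
  refine ⟨existsUnique_isRieszPotential hp hp'.ne hβ, fun I hI => ?_⟩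
  obtain ⟨W, hW, hle⟩ := exists_besovSeminorm_rieszPotential_le hp'.ne hq hα hβ hI
  -- The operator norm controls the `L^p` part, and the total mass of the dilation weight controls
  -- the seminorm.
  refine ⟨max ‖I‖₊ W.toNNReal, fun f hf => ⟨?_, ?_⟩⟩
  · exact (hle f).trans_lt (ENNReal.mul_lt_top hW.lt_top hf)
  · have h1 : ‖I f‖ₑ ≤ (‖I‖₊ : ℝ≥0∞) * ‖f‖ₑ := I.le_opENorm f
    rw [besovNorm, besovNorm, mul_add, ← Lp.enorm_def, ← Lp.enorm_def]
    refine add_le_add (h1.trans ?_) ((hle f).trans ?_)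
    · gcongr
      exact le_max_left _ _
    · gcongr
      rw [← ENNReal.coe_toNNReal hW]
      exact_mod_cast le_max_right _ _
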